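/- Let $L_2$ be the two-sorted language of second-order arithmetic, with number variables $x,y,\dots$, set variables $X,Y,\dots$, the symbols $0,1,+,\cdot,\le,=$ on numbers and $\in$ between numbers and sets. A formula is $\Delta^0_0$ if all its quantifiers are bounded number quantifiers (number and set parameters are allowed), and $\Sigma^0_n$ if it consists of $n$ alternating blocks of number quantifiers, the first one existential, followed by a $\Delta^0_0$ formula. For $n\in\omega$, $\Sigma^0_n\text{-}\mathsf{IND}$ is the scheme of all universal closures of $$\varphi(0)\wedge\forall x\,(\varphi(x)\Rightarrow\varphi(x+1))\Rightarrow\forall x\,\varphi(x),\qquad \varphi\in\Sigma^0_n .$$ The theory $\mathsf{RCA}_0$ consists of axioms saying that the number sort is the non-negative part of a discretely ordered ring, the scheme $\Sigma^0_1\text{-}\mathsf{IND}$, and $\Delta^0_1$-comprehension, i.e. all universal closures of $$\forall x\,(\varphi(x)\Leftrightarrow\neg\psi(x))\Rightarrow\exists X\,\forall x\,(x\in X\Leftrightarrow\varphi(x)),\qquad \varphi,\psi\in\Sigma^0_1,\ X\text{ not free in }\varphi .$$ Write $\mathbb N$ for the number sort. Code pairs by $(a,b)=(a+b)^2+a$,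 and code relations and functions as sets of (codes of) tuples; a set is finite if it is bounded and infinite if it is unbounded. Ordered Ramsey's Theorem for pairs is the following sentence of $L_2$: for every finite set $P$, every partial order $\preceq$ on $P$ and every colouring $C$ assigning to each pair $i<j$ of numbers a colour $C(i,j)\in P$, if $C(i,j)\succeq C(i,k)$ for all $i<j<k$, then there is an infinite set $I\subseteq\mathbb N$ that is homogeneous for $C$, i.e. $C(i,j)=C(i',j')$ for all $i<j$ in $I$ and all $i'<j'$ in $I$. Lemma. The theory $\mathsf{RCA}_0+\Sigma^0_2\text{-}\mathsf{IND}$ proves (in classical two-sorted first-order logic with equality) Ordered Ramsey's Theorem for pairs. -/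

import Mathlib

namespace SOA

/-! ### The two-sorted language of second-order arithmetic (de Bruijn indices)

Number variables and set variables are indexed separately by `ℕ`. A number quantifier binds the
number variable `0` and a set quantifier binds the set variable `0`; the other variables of that
sort are shifted by one under the quantifier. -/

/-- Number terms, over `0`, `1`, `+`, `·`. -/
inductive NTerm : Type
  | var : ℕ → NTerm
  | zero : NTerm
  | one : NTerm
  | add : NTerm → NTerm → NTerm
  | mul : NTerm → NTerm → NTerm

/-- Formulas. The only set terms are the set variables: `mem t X` says that `t` is an element of
the set variable of index `X`. -/
inductive Fml : Type
  | eq : NTerm → NTerm → Fml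
  | le : NTerm → NTerm → Fml
  | mem : NTerm → ℕ → Fml
  | fal : Fml
  | imp : Fml → Fml → Fml
  | allN : Fml → Fml
  | allS : Fml → Fml

namespace NTerm

/-- Simultaneous substitution of terms for number variables. -/
def subst (σ : ℕ → NTerm) : NTerm → NTerm
  | var n => σ n
  | zero => zero
  | one => one
  | add t u => add (t.subst σ) (u.subst σ)
  | mul t u => mul (t.subst σ) (u.subst σ)

/-- Add one to every number variable. -/
def shift (t : NTerm) : NTerm := t.subst fun n => var (n + 1)

/-- The code `(a + b)² + a` of the ordered pair `(a, b)`. -/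
def pair (a b : NTerm) : NTerm := add (mul (add a b) (add a b)) a

/-- The code of the triple `((a, b), c)`. -/
def triple (a b c : NTerm) : NTerm := pair (pair a b) c

end NTerm

open NTerm

/-- Prepend a value to a sequence: `scons a f` is `a, f 0, f 1, …`. -/
def scons {α : Type} (a : α) (f : ℕ → α) : ℕ → α
  | 0 => a
  | n + 1 => f n

namespace Fml

/-- Capture-avoiding simultaneous substitution of number terms for number variables and of set
variables for set variables. -/
def subst : (ℕ → NTerm) → (ℕ → ℕ) → Fml → Fml
  | σ, _, eq t u => eq (t.subst σ) (u.subst σ)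
  | σ, _, le t u => le (t.subst σ) (u.subst σ)
  | σ, τ, mem t X => mem (t.subst σ) (τ X)
  | _, _, fal => fal
  | σ, τ, imp φ ψ => imp (subst σ τ φ) (subst σ τ ψ)
  | σ, τ, allN φ => allN (subst (scons (var 0) fun n => (σ n).shift) τ φ)
  | σ, τ, allS φ => allS (subst σ (scons 0 fun n => τ n + 1) φ)

/-- Add one to every free number variable. -/
def shiftN (φ : Fml) : Fml := φ.subst (fun n => var (n + 1)) id

/-- Add one to every free set variable. -/
def shiftS (φ : Fml) : Fml := φ.subst var (fun n => n + 1)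

/-- Replace the number variable `0` by the term `t`, lowering the other number variables. -/
def instN (t : NTerm) (φ : Fml) : Fml := φ.subst (scons t var) id

/-- Replace the set variable `0` by the set variable `k`, lowering the other set variables. -/
def instS (k : ℕ) (φ : Fml) : Fml := φ.subst var (scons k id)

/-- From `φ(x)` to `φ(x + 1)`, where `x` is the number variable `0`. -/
def atSucc (φ : Fml) : Fml := φ.subst (scons (add (var 0) one) fun n => var (n + 1)) id

def neg (φ : Fml) : Fml := imp φ fal
def and (φ ψ : Fml) : Fml := neg (imp φ (neg ψ))
def or (φ ψ : Fml) : Fml := imp (neg φ) ψ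
def iff (φ ψ : Fml) : Fml := and (imp φ ψ) (imp ψ φ)
def exN (φ : Fml) : Fml := neg (allN (neg φ))
def exS (φ : Fml) : Fml := neg (allS (neg φ))
def lt (t u : NTerm) : Fml := and (le t u) (neg (eq t u))

/-- `∀ x ≤ t, φ`, where `x` does not occur in `t`. -/
def ballN (t : NTerm) (φ : Fml) : Fml := allN (imp (le (var 0) t.shift) φ)

/-- `∃ x ≤ t, φ`, where `x` does not occur in `t`. -/
def bexN (t : NTerm) (φ : Fml) : Fml := exN (and (le (var 0) t.shift) φ)

end Fml

open Fml

/-! ### Provability: natural deduction for classical two-sorted logic with equality -/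

/-- `Prf T Γ φ`: the formula `φ` is derivable from the axioms `T` and the open assumptions `Γ`.
The eigenvariable condition of the generalization rules concerns the assumptions `Γ` only, so that
an axiom of `T` with free variables amounts to its universal closure. -/
inductive Prf (T : Set Fml) : List Fml → Fml → Prop
  | ax {Γ : List Fml} {φ : Fml} : φ ∈ T → Prf T Γ φ
  | hyp {Γ : List Fml} {φ : Fml} : φ ∈ Γ → Prf T Γ φ
  | impI {Γ : List Fml} {φ ψ : Fml} : Prf T (φ :: Γ) ψ → Prf T Γ (imp φ ψ)
  | impE {Γ : List Fml} {φ ψ : Fml} : Prf T Γ (imp φ ψ) → Prf T Γ φ → Prf T Γ ψ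
  | raa {Γ : List Fml} {φ : Fml} : Prf T (neg φ :: Γ) fal → Prf T Γ φ
  | allNI {Γ : List Fml} {φ : Fml} : Prf T (Γ.map shiftN) φ → Prf T Γ (allN φ)
  | allNE {Γ : List Fml} {φ : Fml} (t : NTerm) : Prf T Γ (allN φ) → Prf T Γ (φ.instN t)
  | allSI {Γ : List Fml} {φ : Fml} : Prf T (Γ.map shiftS) φ → Prf T Γ (allS φ)
  | allSE {Γ : List Fml} {φ : Fml} (k : ℕ) : Prf T Γ (allS φ) → Prf T Γ (φ.instS k)
  | eqRefl {Γ : List Fml} (t : NTerm) : Prf T Γ (eq t t)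
  | eqSubst {Γ : List Fml} {t u : NTerm} (φ : Fml) :
      Prf T Γ (eq t u) → Prf T Γ (φ.instN t) → Prf T Γ (φ.instN u)

/-- The theory `T` proves `φ`. -/
def Proves (T : Set Fml) (φ : Fml) : Prop := Prf T [] φ

/-! ### The arithmetical hierarchy -/

/-- `Δ⁰₀` formulas: all quantifiers are bounded number quantifiers (set parameters allowed). -/
inductive IsDelta0 : Fml → Prop
  | eq (t u : NTerm) : IsDelta0 (eq t u)
  | le (t u : NTerm) : IsDelta0 (le t u)
  | mem (t : NTerm) (X : ℕ) : IsDelta0 (mem t X)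
  | fal : IsDelta0 fal
  | imp {φ ψ : Fml} : IsDelta0 φ → IsDelta0 ψ → IsDelta0 (imp φ ψ)
  | ball (t : NTerm) {φ : Fml} : IsDelta0 φ → IsDelta0 (ballN t φ)
  | bex (t : NTerm) {φ : Fml} : IsDelta0 φ → IsDelta0 (bexN t φ)

/-- `IsHier true n` is the class `Σ⁰ₙ` and `IsHier false n` the class `Π⁰ₙ`: `n` alternating
blocks of number quantifiers, starting with `∃` resp. `∀`, in front of a `Δ⁰₀` formula. -/
inductive IsHier : Bool → ℕ → Fml → Prop
  | zero (b : Bool) {φ : Fml} : IsDelta0 φ → IsHier b 0 φ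
  | ofPi {n : ℕ} {φ : Fml} : IsHier false n φ → IsHier true (n + 1) φ
  | ex {n : ℕ} {φ : Fml} : IsHier true (n + 1) φ → IsHier true (n + 1) (exN φ)
  | ofSigma {n : ℕ} {φ : Fml} : IsHier true n φ → IsHier false (n + 1) φ
  | all {n : ℕ} {φ : Fml} : IsHier false (n + 1) φ → IsHier false (n + 1) (allN φ)

/-- `φ` is a `Σ⁰ₙ` formula. -/
def IsSigma (n : ℕ) (φ : Fml) : Prop := IsHier true n φ

/-! ### The axioms

Free variables of an axiom are its parameters; they are understood to be universally quantified. -/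

/-- The number sort is the non-negative part of a discretely ordered ring. -/
inductive BasicAxiom : Fml → Prop
  | add_assoc : BasicAxiom
      (eq (add (add (var 0) (var 1)) (var 2)) (add (var 0) (add (var 1) (var 2))))
  | add_comm : BasicAxiom (eq (add (var 0) (var 1)) (add (var 1) (var 0)))
  | add_zero : BasicAxiom (eq (add (var 0) zero) (var 0))
  | mul_assoc : BasicAxiom
      (eq (mul (mul (var 0) (var 1)) (var 2)) (mul (var 0) (mul (var 1) (var 2))))
  | mul_comm : BasicAxiom (eq (mul (var 0) (var 1)) (mul (var 1) (var 0)))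
  | mul_one : BasicAxiom (eq (mul (var 0) one) (var 0))
  | mul_zero : BasicAxiom (eq (mul (var 0) zero) zero)
  | mul_add : BasicAxiom
      (eq (mul (var 0) (add (var 1) (var 2))) (add (mul (var 0) (var 1)) (mul (var 0) (var 2))))
  | le_refl : BasicAxiom (le (var 0) (var 0))
  | le_antisymm : BasicAxiom
      (imp (le (var 0) (var 1)) (imp (le (var 1) (var 0)) (eq (var 0) (var 1))))
  | le_trans : BasicAxiom
      (imp (le (var 0) (var 1)) (imp (le (var 1) (var 2)) (le (var 0) (var 2))))
  | le_total : BasicAxiom (or (le (var 0) (var 1)) (le (var 1) (var 0)))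
  | add_lt_add : BasicAxiom
      (imp (lt (var 0) (var 1)) (lt (add (var 0) (var 2)) (add (var 1) (var 2))))
  | mul_lt_mul : BasicAxiom
      (imp (lt (var 0) (var 1))
        (imp (lt zero (var 2)) (lt (mul (var 0) (var 2)) (mul (var 1) (var 2)))))
  | zero_le : BasicAxiom (le zero (var 0))
  | zero_lt_one : BasicAxiom (lt zero one)
  | discrete : BasicAxiom (imp (lt zero (var 0)) (le one (var 0)))
  | subtraction : BasicAxiom
      (imp (le (var 0) (var 1)) (exN (eq (add (var 1) (var 0)) (var 2))))

/-- Induction for `φ(x)`, `x` being the number variable `0`: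
`φ(0) ∧ ∀ x (φ(x) → φ(x + 1)) → ∀ x φ(x)`. -/
def indAxiom (φ : Fml) : Fml :=
  imp (and (φ.instN zero) (allN (imp φ φ.atSucc))) (allN φ)

/-- Comprehension for `φ(x)`, `ψ(x)`, `x` being the number variable `0`:
`∀ x (φ(x) ↔ ¬ ψ(x)) → ∃ X ∀ x (x ∈ X ↔ φ(x))`, where `X` does not occur in `φ`. -/
def comprAxiom (φ ψ : Fml) : Fml :=
  imp (allN (iff φ (neg ψ))) (exS (allN (iff (mem (var 0) 0) φ.shiftS)))

/-- The scheme `Σ⁰ₙ-IND`. -/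
def SigmaIND (n : ℕ) : Set Fml := {χ | ∃ φ, IsSigma n φ ∧ χ = indAxiom φ}

/-- The scheme of `Δ⁰₁` comprehension. -/
def Delta1CA : Set Fml := {χ | ∃ φ ψ, IsSigma 1 φ ∧ IsSigma 1 ψ ∧ χ = comprAxiom φ ψ}

/-- The theory `RCA₀`. -/
def RCA0 : Set Fml := {χ | BasicAxiom χ} ∪ SigmaIND 1 ∪ Delta1CA

/-! ### Ordered Ramsey's Theorem for pairs, as a sentence of second-order arithmetic

The arguments `P`, `R`, `C`, `I` below are indices of set variables. -/

/-- The set `P` is finite, i.e. bounded: `∃ b ∀ x (x ∈ P → x ≤ b)`. -/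
def finiteSet (P : ℕ) : Fml := exN (allN (imp (mem (var 0) P) (le (var 0) (var 1))))

/-- The set `I` is infinite, i.e. unbounded: `∀ b ∃ x (b < x ∧ x ∈ I)`. -/
def infiniteSet (I : ℕ) : Fml := allN (exN (and (lt (var 1) (var 0)) (mem (var 0) I)))

/-- The relation `{(x, y) : pair x y ∈ R}` is a partial order on the set `P`; `pair x y ∈ R` is read
as `x ⪯ y`. -/
def partialOrderOn (P R : ℕ) : Fml :=
  and (allN (imp (mem (var 0) P) (mem (pair (var 0) (var 0)) R)))
    (and
      (allN (allN (imp (mem (var 1) P) (imp (mem (var 0) P)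
        (imp (mem (pair (var 1) (var 0)) R) (imp (mem (pair (var 0) (var 1)) R)
          (eq (var 1) (var 0))))))))
      (allN (allN (allN (imp (mem (var 2) P) (imp (mem (var 1) P) (imp (mem (var 0) P)
        (imp (mem (pair (var 2) (var 1)) R) (imp (mem (pair (var 1) (var 0)) R)
          (mem (pair (var 2) (var 0)) R))))))))))

/-- `C` is a colouring of the pairs `i < j` by elements of `P`: for all `i < j` there is `p ∈ P`
which is the one and only number with `triple i j p ∈ C`. This `p` is the colour `C(i, j)`. -/
def colouring (C P : ℕ) : Fml :=
  allN (allN (imp (lt (var 1) (var 0))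
    (exN (and (mem (var 0) P) (and (mem (triple (var 2) (var 1) (var 0)) C)
      (allN (imp (mem (triple (var 3) (var 2) (var 0)) C) (eq (var 0) (var 1)))))))))

/-- For all `i < j < k`: `C(i, j) ⪰ C(i, k)`. The variables `i, j, k, p, q` have the indices
`4, 3, 2, 1, 0`, with `p = C(i, j)` and `q = C(i, k)`. -/
def orderedColouring (C R : ℕ) : Fml :=
  allN (allN (allN (allN (allN
    (imp (lt (var 4) (var 3)) (imp (lt (var 3) (var 2))
      (imp (mem (triple (var 4) (var 3) (var 1)) C) (imp (mem (triple (var 4) (var 2) (var 0)) C)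
        (mem (pair (var 0) (var 1)) R)))))))))

/-- `C(i, j) = C(i', j')` for all `i < j` in `I` and all `i' < j'` in `I`. The variables
`i, j, i', j', p, q` have the indices `5, 4, 3, 2, 1, 0`, with `p = C(i, j)`, `q = C(i', j')`. -/
def homogeneous (C I : ℕ) : Fml :=
  allN (allN (allN (allN (allN (allN
    (imp (mem (var 5) I) (imp (mem (var 4) I) (imp (lt (var 5) (var 4))
      (imp (mem (var 3) I) (imp (mem (var 2) I) (imp (lt (var 3) (var 2))
        (imp (mem (triple (var 5) (var 4) (var 1)) C)
          (imp (mem (triple (var 3) (var 2) (var 0)) C)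
            (eq (var 1) (var 0)))))))))))))))

/-- Ordered Ramsey's Theorem for pairs. In the premises `P`, `⪯`, `C` have the indices `2, 1, 0`;
under the quantifier `∃ I` the set `I` has index `0` and `C` has index `1`. -/
def orderedRamsey : Fml :=
  allS (allS (allS
    (imp (and (finiteSet 2) (and (partialOrderOn 2 1) (and (colouring 0 2) (orderedColouring 0 1))))
      (exS (and (infiniteSet 0) (homogeneous 1 0))))))

end SOA

namespace SOA

open NTerm Fml

/-! ### Substitution -/

namespace NTerm

/-! By completeness (`proves_of_forall_sat`) it suffices to verify the principle in every structure
satisfying the axioms. The structure may be nonstandard, so each infinite or finite set used must be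
obtained from comprehension or induction for a formula of the right complexity.

Let `a` bound the colours, and call a colour persistent if it occurs on pairs `i < j` with `i`
arbitrarily large. Σ⁰₂ induction, needed only here, yields a coded finite set consisting of the
persistent colours `≤ a` and a stage `b` beyond which no other colour occurs (`exists_stage`). Let
`p` be a minimal persistent colour (`exists_minimal`). If `b < i < j < k` and `C(i, j) = p`, then
`C(i, k) ⪯ p` is again persistent, hence equals `p`: once a row reaches `p` it stays there. Since
`p` is persistent, such pairs `(i, j)` occur arbitrarily far out. A greedy choice gives an unbounded
set of them in which each pair lies wholly before the next (`exists_separated_pairs`), and the first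
components form the homogeneous set: for chosen pairs `i < j < i' < j'` stability gives `C(i, i') =
p`.

Finite sets are coded by divisibility: `x` belongs to the code `c, d` when `1 + (x + 1) * d` divides
`c`. If `d` is divisible by all positive numbers up to `a`, these moduli are independent for `x ≤ a`
(`codeMem_of_mul`), so elements are added by multiplication. Division by a modulus keeps all other
elements and strictly decreases `c`, so the value of `c` can replace a count of elements. -/

theorem subst_subst (t : NTerm) (σ σ' : ℕ → NTerm) :
    (t.subst σ).subst σ' = t.subst fun n => (σ n).subst σ' := by
  induction t <;> simp_all [subst]

theorem subst_var (t : NTerm) : t.subst var = t := by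
  induction t <;> simp_all [subst]

/-- A strict upper bound for the variables of a term. -/
def bound : NTerm → ℕ
  | var n => n + 1
  | zero => 0
  | one => 0
  | add t u => max t.bound u.bound
  | mul t u => max t.bound u.bound

theorem subst_congr {σ σ' : ℕ → NTerm} (t : NTerm) (h : ∀ n < t.bound, σ n = σ' n) :
    t.subst σ = t.subst σ' := by
  induction t <;> simp_all [subst, bound]

end NTerm

/-- The substitution `σ` under a number quantifier. -/
def liftN (σ : ℕ → NTerm) : ℕ → NTerm := scons (var 0) fun n => (σ n).shift

/-- The renaming `τ` of set variables under a set quantifier. -/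
def liftS (τ : ℕ → ℕ) : ℕ → ℕ := scons 0 fun n => τ n + 1

theorem liftN_var : liftN var = var := by
  funext n; cases n <;> rfl

theorem liftS_id : liftS id = id := by
  funext n; cases n <;> rfl

theorem liftN_comp (σ σ' : ℕ → NTerm) :
    (fun n => (liftN σ n).subst (liftN σ')) = liftN fun n => (σ n).subst σ' := by
  funext n
  cases n with
  | zero => rfl
  | succ n => simp [liftN, scons, shift, subst_subst, NTerm.subst]

theorem liftS_comp (τ τ' : ℕ → ℕ) : (liftS τ' ∘ liftS τ) = liftS (τ' ∘ τ) := by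
  funext n; cases n <;> rfl

namespace Fml

theorem subst_allN (σ : ℕ → NTerm) (τ : ℕ → ℕ) (φ : Fml) :
    (allN φ).subst σ τ = allN (φ.subst (liftN σ) τ) := rfl

theorem subst_allS (σ : ℕ → NTerm) (τ : ℕ → ℕ) (φ : Fml) :
    (allS φ).subst σ τ = allS (φ.subst σ (liftS τ)) := rfl

theorem subst_subst (φ : Fml) : ∀ (σ σ' : ℕ → NTerm) (τ τ' : ℕ → ℕ),
    (φ.subst σ τ).subst σ' τ' = φ.subst (fun n => (σ n).subst σ') (τ' ∘ τ) := by
  induction φ with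
  | allN φ ih => intros; simp only [subst_allN, ih, liftN_comp]
  | allS φ ih => intros; simp only [subst_allS, ih, liftS_comp]
  | _ => simp_all [subst, NTerm.subst_subst]

theorem subst_var_id (φ : Fml) : φ.subst var id = φ := by
  induction φ with
  | allN φ ih => rw [subst_allN, liftN_var, ih]
  | allS φ ih => rw [subst_allS, liftS_id, ih]
  | _ => simp_all [subst, NTerm.subst_var]

/-- A strict upper bound for the number variables of a formula. -/
def boundN : Fml → ℕ
  | eq t u => max t.bound u.bound
  | le t u => max t.bound u.bound
  | mem t _ => t.bound
  | fal => 0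
  | imp φ ψ => max φ.boundN ψ.boundN
  | allN φ => φ.boundN
  | allS φ => φ.boundN

/-- A strict upper bound for the set variables of a formula. -/
def boundS : Fml → ℕ
  | eq _ _ => 0
  | le _ _ => 0
  | mem _ X => X + 1
  | fal => 0
  | imp φ ψ => max φ.boundS ψ.boundS
  | allN φ => φ.boundS
  | allS φ => φ.boundS

/-- A formula sees only finitely many variables. This is what allows an arbitrary substitution to be
replaced by a finite list of instantiations, or by one that treats a fresh variable specially. -/
theorem subst_congr (φ : Fml) : ∀ {σ σ' : ℕ → NTerm} {τ τ' : ℕ → ℕ},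
    (∀ n < φ.boundN, σ n = σ' n) → (∀ n < φ.boundS, τ n = τ' n) →
    φ.subst σ τ = φ.subst σ' τ' := by
  induction φ with
  | eq t u =>
    intro σ σ' τ τ' h _
    simp only [boundN, lt_max_iff] at h
    rw [subst, subst, t.subst_congr fun n hn => h n (.inl hn),
      u.subst_congr fun n hn => h n (.inr hn)]
  | le t u =>
    intro σ σ' τ τ' h _
    simp only [boundN, lt_max_iff] at h
    rw [subst, subst, t.subst_congr fun n hn => h n (.inl hn),
      u.subst_congr fun n hn => h n (.inr hn)]
  | mem t X =>
    intro σ σ' τ τ' h h'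
    rw [subst, subst, t.subst_congr h, h' X (Nat.lt_succ_self X)]
  | fal => intros; rfl
  | imp φ ψ ihφ ihψ =>
    intro σ σ' τ τ' h h'
    simp only [boundN, boundS, lt_max_iff] at h h'
    rw [subst, subst, ihφ (fun n hn => h n (.inl hn)) fun n hn => h' n (.inl hn),
      ihψ (fun n hn => h n (.inr hn)) fun n hn => h' n (.inr hn)]
  | allN φ ih =>
    intro σ σ' τ τ' h h'
    rw [subst_allN, subst_allN, ih (fun n hn => ?_) h']
    cases n with
    | zero => rfl
    | succ n => simp only [liftN, scons, h n (Nat.lt_of_succ_lt hn)]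
  | allS φ ih =>
    intro σ σ' τ τ' h h'
    rw [subst_allS, subst_allS, ih h (fun n hn => ?_)]
    cases n with
    | zero => rfl
    | succ n => simp only [liftS, scons, h' n (Nat.lt_of_succ_lt hn)]

theorem subst_instN (φ : Fml) (t : NTerm) (σ : ℕ → NTerm) (τ : ℕ → ℕ) :
    (φ.instN t).subst σ τ = (φ.subst (liftN σ) τ).instN (t.subst σ) := by
  rw [instN, instN, subst_subst, subst_subst]
  congr 1
  funext n
  cases n with
  | zero => rfl
  | succ n => simp only [liftN, scons, shift, NTerm.subst_subst, NTerm.subst, NTerm.subst_var]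

theorem subst_instS (φ : Fml) (k : ℕ) (σ : ℕ → NTerm) (τ : ℕ → ℕ) :
    (φ.instS k).subst σ τ = (φ.subst σ (liftS τ)).instS (τ k) := by
  rw [instS, instS, subst_subst, subst_subst]
  congr 1
  · funext n
    simp only [NTerm.subst, NTerm.subst_var]
  · funext n
    cases n <;> rfl

theorem subst_shiftN (φ : Fml) (σ : ℕ → NTerm) (τ : ℕ → ℕ) :
    φ.shiftN.subst (liftN σ) τ = (φ.subst σ τ).shiftN := by
  rw [shiftN, shiftN, subst_subst, subst_subst]
  rfl

theorem subst_shiftS (φ : Fml) (σ : ℕ → NTerm) (τ : ℕ → ℕ) :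
    φ.shiftS.subst σ (liftS τ) = (φ.subst σ τ).shiftS := by
  rw [shiftS, shiftS, subst_subst, subst_subst]
  congr 1
  funext n
  simp only [NTerm.subst, NTerm.subst_var]

end Fml

/-! ### Structural properties of provability -/

namespace Prf

variable {T : Set Fml}

theorem weaken {Γ Δ : List Fml} {φ : Fml} (h : Prf T Γ φ) (hΔ : Γ ⊆ Δ) : Prf T Δ φ := by
  induction h generalizing Δ with
  | ax h => exact ax h
  | hyp h => exact hyp (hΔ h)
  | impI _ ih => exact impI (ih (List.cons_subset_cons _ hΔ))
  | impE _ _ ih₁ ih₂ => exact impE (ih₁ hΔ) (ih₂ hΔ)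
  | raa _ ih => exact raa (ih (List.cons_subset_cons _ hΔ))
  | allNI _ ih => exact allNI (ih (List.map_subset _ hΔ))
  | allNE t _ ih => exact allNE t (ih hΔ)
  | allSI _ ih => exact allSI (ih (List.map_subset _ hΔ))
  | allSE k _ ih => exact allSE k (ih hΔ)
  | eqRefl t => exact eqRefl t
  | eqSubst φ _ _ ih₁ ih₂ => exact eqSubst φ (ih₁ hΔ) (ih₂ hΔ)

/-- The substitution of the terms in a list for the first number variables. -/
def listSubst (l : List NTerm) : ℕ → NTerm := l.foldr scons var

/-- The substitution of the set variables in a list for the first set variables. -/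
def listRename (l : List ℕ) : ℕ → ℕ := l.foldr scons id

theorem listSubst_add (l : List NTerm) (n : ℕ) : listSubst l (n + l.length) = var n := by
  induction l with
  | nil => rfl
  | cons t l ih => exact ih

theorem listRename_add (l : List ℕ) (n : ℕ) : listRename l (n + l.length) = n := by
  induction l with
  | nil => rfl
  | cons t l ih => exact ih

theorem listSubst_map_range (σ : ℕ → NTerm) (m n : ℕ) (h : n < m) :
    listSubst ((List.range m).map σ) n = σ n := by
  induction m generalizing σ n with
  | zero => omega
  | succ m ih =>
    rw [List.range_succ_eq_map, List.map_cons, List.map_map]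
    cases n with
    | zero => rfl
    | succ n => exact ih (σ ∘ Nat.succ) n (by omega)

theorem listRename_map_range (τ : ℕ → ℕ) (m n : ℕ) (h : n < m) :
    listRename ((List.range m).map τ) n = τ n := by
  induction m generalizing τ n with
  | zero => omega
  | succ m ih =>
    rw [List.range_succ_eq_map, List.map_cons, List.map_map]
    cases n with
    | zero => rfl
    | succ n => exact ih (τ ∘ Nat.succ) n (by omega)

/-- With no open assumptions every variable may be generalized and then instantiated, so the
substitution is carried out one variable at a time. -/
theorem subst_listSubst (l : List NTerm) {φ : Fml} (h : Prf T [] φ) :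
    Prf T [] (φ.subst (listSubst l) id) := by
  induction l generalizing φ with
  | nil => simpa only [listSubst, List.foldr, subst_var_id] using h
  | cons t l ih =>
    -- The variables of `t` are raised by `l.length`, so that the remaining instantiations by `l`
    -- return them to their original values.
    have := ih (allNE (t.subst fun n => var (n + l.length)) (allNI (Γ := []) h))
    rw [instN, Fml.subst_subst] at this
    convert this using 1
    refine congrArg (fun σ => Fml.subst σ id φ) (funext fun n => ?_)
    cases n with
    | zero =>
      simp only [scons, NTerm.subst_subst, NTerm.subst, listSubst_add, NTerm.subst_var]
      rfl
    | succ n => rfl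

theorem subst_listRename (l : List ℕ) {φ : Fml} (h : Prf T [] φ) :
    Prf T [] (φ.subst var (listRename l)) := by
  induction l generalizing φ with
  | nil => simpa only [listRename, List.foldr, subst_var_id] using h
  | cons t l ih =>
    have := ih (allSE (t + l.length) (allSI (Γ := []) h))
    rw [instS, Fml.subst_subst] at this
    convert this using 1
    refine congrArg (fun τ => Fml.subst var τ φ) (funext fun n => ?_)
    cases n with
    | zero => exact (listRename_add l t).symm
    | succ n => rfl

theorem subst_nil {φ : Fml} (h : Prf T [] φ) (σ : ℕ → NTerm) (τ : ℕ → ℕ) :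
    Prf T [] (φ.subst σ τ) := by
  have := subst_listSubst ((List.range (φ.subst var τ).boundN).map σ)
    (subst_listRename ((List.range φ.boundS).map τ) h)
  have e : φ.subst var (listRename ((List.range φ.boundS).map τ)) = φ.subst var τ :=
    φ.subst_congr (fun _ _ => rfl) fun n hn => listRename_map_range τ _ n hn
  rw [e, Fml.subst_congr (σ' := σ) (τ' := id) _
    (fun n hn => listSubst_map_range σ _ n hn) (fun _ _ => rfl), Fml.subst_subst] at this
  exact this

/-- The axiom case needs `subst_nil`, because `T` itself is not assumed closed under substitution.
-/
theorem subst {Γ : List Fml} {φ : Fml} (h : Prf T Γ φ) : ∀ (σ : ℕ → NTerm) (τ : ℕ → ℕ),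
    Prf T (Γ.map (Fml.subst σ τ)) (φ.subst σ τ) := by
  induction h with
  | ax h => exact fun σ τ => (subst_nil (ax h) σ τ).weaken (by simp)
  | hyp h => exact fun σ τ => hyp (List.mem_map_of_mem h)
  | impI _ ih => exact fun σ τ => impI (ih σ τ)
  | impE _ _ ih₁ ih₂ => exact fun σ τ => impE (ih₁ σ τ) (ih₂ σ τ)
  | raa _ ih => exact fun σ τ => raa (ih σ τ)
  | allNI _ ih =>
    intro σ τ
    refine allNI ?_
    have := ih (liftN σ) τ
    rw [List.map_map] at this ⊢
    rwa [show shiftN ∘ Fml.subst σ τ = Fml.subst (liftN σ) τ ∘ shiftN from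
      funext fun ψ => (subst_shiftN ψ σ τ).symm]
  | allNE t _ ih =>
    intro σ τ
    rw [subst_instN]
    exact allNE _ (ih σ τ)
  | allSI _ ih =>
    intro σ τ
    refine allSI ?_
    have := ih σ (liftS τ)
    rw [List.map_map] at this ⊢
    rwa [show shiftS ∘ Fml.subst σ τ = Fml.subst σ (liftS τ) ∘ shiftS from
      funext fun ψ => (subst_shiftS ψ σ τ).symm]
  | allSE k _ ih =>
    intro σ τ
    rw [subst_instS]
    exact allSE _ (ih σ τ)
  | eqRefl t => exact fun σ τ => eqRefl _
  | eqSubst φ _ _ ih₁ ih₂ =>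
    intro σ τ
    rw [subst_instN]
    refine eqSubst _ (ih₁ σ τ) ?_
    rw [← subst_instN]
    exact ih₂ σ τ

/-- The rule with a named eigenvariable reduces to the de Bruijn rule: the substitution sending the
fresh `k` to `0` and raising all smaller variables acts on `Γ` as the shift. -/
theorem allNI_of_fresh {Γ : List Fml} {φ : Fml} {k : ℕ} (hΓ : ∀ ψ ∈ Γ, ψ.boundN ≤ k)
    (hφ : φ.boundN ≤ k) (h : Prf T Γ (φ.instN (var k))) : Prf T Γ (allN φ) := by
  refine allNI ?_
  have := h.subst (fun n => if n < k then var (n + 1) else var 0) id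
  have e : Γ.map (Fml.subst (fun n => if n < k then var (n + 1) else var 0) id) = Γ.map shiftN := by
    refine List.map_congr_left fun ψ hψ => ψ.subst_congr (fun n hn => ?_) fun _ _ => rfl
    simp only [if_pos (hn.trans_le (hΓ ψ hψ))]
  rw [e, instN, Fml.subst_subst] at this
  convert this
  rw [← subst_var_id φ, Fml.subst_subst]
  refine (φ.subst_congr (fun n hn => ?_) fun _ _ => rfl).symm
  cases n with
  | zero => simp [scons, NTerm.subst]
  | succ n => simp [scons, NTerm.subst, show n < k by omega]

theorem allSI_of_fresh {Γ : List Fml} {φ : Fml} {k : ℕ} (hΓ : ∀ ψ ∈ Γ, ψ.boundS ≤ k)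
    (hφ : φ.boundS ≤ k) (h : Prf T Γ (φ.instS k)) : Prf T Γ (allS φ) := by
  refine allSI ?_
  have := h.subst var (fun n => if n < k then n + 1 else 0)
  have e : Γ.map (Fml.subst var (fun n => if n < k then n + 1 else 0)) = Γ.map shiftS := by
    refine List.map_congr_left fun ψ hψ => ψ.subst_congr (fun _ _ => rfl) fun n hn => ?_
    simp only [if_pos (hn.trans_le (hΓ ψ hψ))]
  rw [e, instS, Fml.subst_subst] at this
  convert this
  rw [← subst_var_id φ, Fml.subst_subst]
  refine (φ.subst_congr (fun n _ => ?_) fun n hn => ?_).symm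
  · simp [NTerm.subst]
  · cases n with
    | zero => simp [scons]
    | succ n => simp [scons, show n < k by omega]

end Prf

/-! ### Semantics -/

section Semantics

variable {N S : Type} [Zero N] [One N] [Add N] [Mul N] [LE N]

/-- The value of a term under an assignment. -/
def NTerm.eval (v : ℕ → N) : NTerm → N
  | var n => v n
  | zero => 0
  | one => 1
  | add t u => t.eval v + u.eval v
  | mul t u => t.eval v * u.eval v

/-- Satisfaction in the structure with number sort `N`, set sort `S` and membership `E`. -/
def Fml.Sat (E : N → S → Prop) : (ℕ → N) → (ℕ → S) → Fml → Prop
  | v, _, eq t u => t.eval v = u.eval v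
  | v, _, le t u => t.eval v ≤ u.eval v
  | v, s, mem t X => E (t.eval v) (s X)
  | _, _, fal => False
  | v, s, imp φ ψ => Sat E v s φ → Sat E v s ψ
  | v, s, allN φ => ∀ x, Sat E (scons x v) s φ
  | v, s, allS φ => ∀ X, Sat E v (scons X s) φ

omit [LE N] in
theorem NTerm.eval_subst (v : ℕ → N) (σ : ℕ → NTerm) (t : NTerm) :
    (t.subst σ).eval v = t.eval fun n => (σ n).eval v := by
  induction t <;> simp_all [NTerm.subst, NTerm.eval]

omit [LE N] in
theorem NTerm.eval_shift (v : ℕ → N) (a : N) (t : NTerm) :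
    t.shift.eval (scons a v) = t.eval v := by
  rw [NTerm.shift, NTerm.eval_subst]
  rfl

theorem Fml.sat_subst (E : N → S → Prop) (φ : Fml) : ∀ (v : ℕ → N) (s : ℕ → S)
    (σ : ℕ → NTerm) (τ : ℕ → ℕ),
    (φ.subst σ τ).Sat E v s ↔ φ.Sat E (fun n => (σ n).eval v) (s ∘ τ) := by
  induction φ with
  | allN φ ih =>
    intro v s σ τ
    refine forall_congr' fun x => ?_
    rw [ih]
    refine iff_of_eq (congrArg (fun w => φ.Sat E w (s ∘ τ)) (funext fun n => ?_))
    cases n with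
    | zero => rfl
    | succ n => exact NTerm.eval_shift v x (σ n)
  | allS φ ih =>
    intro v s σ τ
    refine forall_congr' fun X => ?_
    rw [ih]
    refine iff_of_eq (congrArg (fun w => φ.Sat E _ w) (funext fun n => ?_))
    cases n <;> rfl
  | _ => simp_all [Fml.subst, Fml.Sat, NTerm.eval_subst]

end Semantics

/-! ### Completeness -/

/-- An injective coding of terms. -/
def NTerm.code : NTerm → ℕ
  | var n => Nat.pair 0 n
  | zero => Nat.pair 1 0
  | one => Nat.pair 2 0
  | add t u => Nat.pair 3 (Nat.pair t.code u.code)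
  | mul t u => Nat.pair 4 (Nat.pair t.code u.code)

theorem NTerm.code_injective : Function.Injective NTerm.code := by
  intro t
  induction t <;> intro u h <;> cases u <;> simp_all [NTerm.code, Nat.pair_eq_pair] <;> grind

/-- An injective coding of formulas. -/
def Fml.code : Fml → ℕ
  | eq t u => Nat.pair 0 (Nat.pair t.code u.code)
  | le t u => Nat.pair 1 (Nat.pair t.code u.code)
  | mem t X => Nat.pair 2 (Nat.pair t.code X)
  | fal => Nat.pair 3 0
  | imp φ ψ => Nat.pair 4 (Nat.pair φ.code ψ.code)
  | allN φ => Nat.pair 5 φ.code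
  | allS φ => Nat.pair 6 φ.code

theorem Fml.code_injective : Function.Injective Fml.code := by
  intro φ
  induction φ <;> intro ψ h <;> cases ψ <;>
    simp_all [Fml.code, Nat.pair_eq_pair, NTerm.code_injective.eq_iff] <;> grind

theorem exists_bound (f : Fml → ℕ) (Γ : List Fml) : ∃ k, ∀ ψ ∈ Γ, f ψ ≤ k := by
  induction Γ with
  | nil => exact ⟨0, by simp⟩
  | cons φ Γ ih =>
    obtain ⟨k, hk⟩ := ih
    refine ⟨max (f φ) k, fun ψ hψ => ?_⟩
    rcases List.mem_cons.1 hψ with rfl | h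
    · exact le_max_left _ _
    · exact (hk ψ h).trans (le_max_right _ _)

namespace Prf

variable {T : Set Fml}

theorem cut {Γ : List Fml} {φ ψ : Fml} (h : Prf T Γ φ) (h' : Prf T (φ :: Γ) ψ) : Prf T Γ ψ :=
  impE (impI h') h

theorem exfalso {Γ : List Fml} (φ : Fml) (h : Prf T Γ fal) : Prf T Γ φ :=
  raa (h.weaken (List.subset_cons_self _ _))

/-- A consistent context extends to one that decides a given formula, with a witness if the
formula is refuted and universally quantified. -/
theorem exists_extension {Γ : List Fml} (hΓ : ¬ Prf T Γ fal) (ψ : Fml) :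
    ∃ Δ, Γ ⊆ Δ ∧ ¬ Prf T Δ fal ∧ (ψ ∈ Δ ∨ neg ψ ∈ Δ) ∧
      (∀ χ, ψ = allN χ → ψ ∈ Δ ∨ ∃ k, neg (χ.instN (var k)) ∈ Δ) ∧
      (∀ χ, ψ = allS χ → ψ ∈ Δ ∨ ∃ k, neg (χ.instS k) ∈ Δ) := by
  by_cases h : Prf T (ψ :: Γ) fal
  · have hn : Prf T Γ (neg ψ) := impI h
    have hc : ¬ Prf T (neg ψ :: Γ) fal := fun h' => hΓ (cut hn h')
    by_cases hN : ∃ χ, ψ = allN χ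
    · obtain ⟨χ, rfl⟩ := hN
      obtain ⟨k, hk⟩ := exists_bound boundN (χ :: Γ)
      -- If adding the negated instance at the fresh `k` were inconsistent, the instance would be
      -- provable, hence so would `allN χ`, against the consistency of `neg (allN χ) :: Γ`.
      refine ⟨neg (χ.instN (var k)) :: neg (allN χ) :: Γ, fun _ => by simp +contextual, fun h' => ?_,
        .inr (by simp), fun χ' e => .inr ⟨k, ?_⟩, fun χ' e => by cases e⟩
      · refine hc (impE (hyp (List.mem_cons_self ..)) (allNI_of_fresh (k := k) ?_ ?_ (raa h')))
        · intro θ hθ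
          rcases List.mem_cons.1 hθ with rfl | hθ
          · simpa [neg, boundN] using hk χ (by simp)
          · exact hk θ (by simp [hθ])
        · exact hk χ (by simp)
      · cases e
        simp
    by_cases hS : ∃ χ, ψ = allS χ
    · obtain ⟨χ, rfl⟩ := hS
      obtain ⟨k, hk⟩ := exists_bound boundS (χ :: Γ)
      refine ⟨neg (χ.instS k) :: neg (allS χ) :: Γ, fun _ => by simp +contextual, fun h' => ?_,
        .inr (by simp), fun χ' e => (by cases e), fun χ' e => .inr ⟨k, ?_⟩⟩
      · refine hc (impE (hyp (List.mem_cons_self ..)) (allSI_of_fresh (k := k) ?_ ?_ (raa h')))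
        · intro θ hθ
          rcases List.mem_cons.1 hθ with rfl | hθ
          · simpa [neg, boundS] using hk χ (by simp)
          · exact hk θ (by simp [hθ])
        · exact hk χ (by simp)
      · cases e
        simp
    · exact ⟨neg ψ :: Γ, List.subset_cons_self _ _, hc, .inr (List.mem_cons_self ..),
        fun χ e => (hN ⟨χ, e⟩).elim, fun χ e => (hS ⟨χ, e⟩).elim⟩
  · exact ⟨ψ :: Γ, List.subset_cons_self _ _, h, .inl (List.mem_cons_self ..),
      fun _ _ => .inl (List.mem_cons_self ..), fun _ _ => .inl (List.mem_cons_self ..)⟩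

end Prf

/-- A maximal consistent set of formulas, closed under provability from `T` and with witnesses for
all quantifiers. -/
structure IsHenkin (T G : Set Fml) : Prop where
  closed : ∀ {Γ : List Fml} {φ : Fml}, Prf T Γ φ → (∀ ψ ∈ Γ, ψ ∈ G) → φ ∈ G
  fal_notMem : fal ∉ G
  mem_or_neg : ∀ φ, φ ∈ G ∨ neg φ ∈ G
  witN : ∀ φ, allN φ ∈ G ∨ ∃ k, neg (φ.instN (var k)) ∈ G
  witS : ∀ φ, allS φ ∈ G ∨ ∃ k, neg (φ.instS k) ∈ G

/-- Formulas are countable, so stage `n` treats the formula with code `n` by `Prf.exists_extension`.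
Every stage is a finite list, which guarantees fresh variables, and every derivation uses
assumptions from a single stage. -/
theorem exists_isHenkin {T : Set Fml} {Γ : List Fml} (hΓ : ¬ Prf T Γ fal) :
    ∃ G, IsHenkin T G ∧ ∀ φ ∈ Γ, φ ∈ G := by
  choose! ext hsub hcon hdec hN hS using
    fun (p : List Fml × Fml) (h : ¬ Prf T p.1 fal) => Prf.exists_extension h p.2
  have : Nonempty Fml := ⟨fal⟩
  let D : ℕ → Fml := Function.invFun Fml.code
  have hD (φ : Fml) : D φ.code = φ := Function.leftInverse_invFun Fml.code_injective φ
  let Δ : ℕ → List Fml := fun n => Nat.rec Γ (fun n Θ => ext (Θ, D n)) n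
  have hΔ (n : ℕ) : ¬ Prf T (Δ n) fal := by
    induction n with
    | zero => exact hΓ
    | succ n ih => exact hcon (Δ n, D n) ih
  have hmono : ∀ {m n : ℕ}, m ≤ n → Δ m ⊆ Δ n := by
    intro m n h
    induction h with
    | refl => exact fun _ h => h
    | @step n _ ih => exact fun _ h => hsub (Δ n, D n) (hΔ n) (ih h)
  let G : Set Fml := {φ | ∃ n, φ ∈ Δ n}
  have hstage (Θ : List Fml) (h : ∀ ψ ∈ Θ, ψ ∈ G) : ∃ n, Θ ⊆ Δ n := by
    induction Θ with
    | nil => exact ⟨0, by simp⟩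
    | cons φ Θ ih =>
      obtain ⟨m, hm⟩ := h φ (by simp)
      obtain ⟨n, hn⟩ := ih fun ψ hψ => h ψ (by simp [hψ])
      exact ⟨max m n, List.cons_subset.2
        ⟨hmono (le_max_left _ _) hm, fun _ h => hmono (le_max_right _ _) (hn h)⟩⟩
  have hmem (φ : Fml) : φ ∈ G ∨ neg φ ∈ G := by
    have := hdec (Δ φ.code, D φ.code) (hΔ _)
    simp only [hD] at this
    exact this.imp (fun h => ⟨φ.code + 1, by simpa only [Δ, hD] using h⟩)
      fun h => ⟨φ.code + 1, by simpa only [Δ, hD] using h⟩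
  refine ⟨G, ⟨?_, ?_, hmem, ?_, ?_⟩, fun φ h => ⟨0, h⟩⟩
  · intro Θ φ h hΘ
    refine (hmem φ).resolve_right fun hn => ?_
    obtain ⟨n, hn⟩ := hstage (neg φ :: Θ) (by simpa using ⟨hn, hΘ⟩)
    rw [List.cons_subset] at hn
    exact hΔ n (.impE (.hyp hn.1) (h.weaken hn.2))
  · rintro ⟨n, hn⟩
    exact hΔ n (.hyp hn)
  · intro φ
    have := hN (Δ (allN φ).code, D (allN φ).code) (hΔ _) φ (hD _)
    simp only [hD] at this
    exact this.imp (fun h => ⟨(allN φ).code + 1, by simpa only [Δ, hD] using h⟩)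
      fun ⟨k, h⟩ => ⟨k, (allN φ).code + 1, by simpa only [Δ, hD] using h⟩
  · intro φ
    have := hS (Δ (allS φ).code, D (allS φ).code) (hΔ _) φ (hD _)
    simp only [hD] at this
    exact this.imp (fun h => ⟨(allS φ).code + 1, by simpa only [Δ, hD] using h⟩)
      fun ⟨k, h⟩ => ⟨k, (allS φ).code + 1, by simpa only [Δ, hD] using h⟩

namespace IsHenkin

variable {T G : Set Fml} (hG : IsHenkin T G)

include hG

theorem thm {φ : Fml} (h : Prf T [] φ) : φ ∈ G := hG.closed h (by simp)

theorem imp_mem_iff (φ ψ : Fml) : imp φ ψ ∈ G ↔ (φ ∈ G → ψ ∈ G) := by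
  refine ⟨fun h h' => hG.closed (Γ := [imp φ ψ, φ]) (.impE (φ := φ) (.hyp (by simp)) (.hyp (by simp)))
    (by simp [h, h']), fun h => ?_⟩
  rcases hG.mem_or_neg φ with h' | h'
  · exact hG.closed (Γ := [ψ]) (.impI (.hyp (by simp))) (by simp [h h'])
  · exact hG.closed (Γ := [neg φ])
      (.impI (.exfalso _ (.impE (φ := φ) (.hyp (by simp [neg])) (.hyp (by simp))))) (by simp [h'])

theorem neg_mem_iff (φ : Fml) : neg φ ∈ G ↔ φ ∉ G := by
  rw [neg, hG.imp_mem_iff]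
  simp [hG.fal_notMem]

theorem allN_mem_iff (φ : Fml) : allN φ ∈ G ↔ ∀ t, φ.instN t ∈ G := by
  refine ⟨fun h t => hG.closed (Γ := [allN φ]) (.allNE t (.hyp (by simp))) (by simp [h]),
    fun h => (hG.witN φ).resolve_right ?_⟩
  rintro ⟨k, hk⟩
  exact (hG.neg_mem_iff _).1 hk (h _)

theorem allS_mem_iff (φ : Fml) : allS φ ∈ G ↔ ∀ k, φ.instS k ∈ G := by
  refine ⟨fun h t => hG.closed (Γ := [allS φ]) (.allSE t (.hyp (by simp))) (by simp [h]),
    fun h => (hG.witS φ).resolve_right ?_⟩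
  rintro ⟨k, hk⟩
  exact (hG.neg_mem_iff _).1 hk (h _)

theorem instN_congr {t u : NTerm} (h : eq t u ∈ G) (φ : Fml) (h' : φ.instN t ∈ G) :
    φ.instN u ∈ G :=
  hG.closed (Γ := [eq t u, φ.instN t]) (.eqSubst (t := t) φ (.hyp (by simp)) (.hyp (by simp)))
    (by simp [h, h'])

theorem eq_refl (t : NTerm) : eq t t ∈ G := hG.thm (.eqRefl t)

omit hG in
theorem subst_shift_scons (t u : NTerm) : u.shift.subst (scons t var) = u := by
  rw [NTerm.shift, NTerm.subst_subst]
  exact u.subst_var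

theorem eq_symm {t u : NTerm} (h : eq t u ∈ G) : eq u t ∈ G := by
  have := hG.instN_congr h (eq (var 0) t.shift)
  simp only [instN, Fml.subst, NTerm.subst, subst_shift_scons, scons] at this
  exact this (hG.eq_refl t)

theorem eq_trans {t u w : NTerm} (h : eq t u ∈ G) (h' : eq u w ∈ G) : eq t w ∈ G := by
  have := hG.instN_congr h' (eq t.shift (var 0))
  simp only [instN, Fml.subst, NTerm.subst, subst_shift_scons, scons] at this
  exact this h

theorem add_congr {t u t' u' : NTerm} (h : eq t u ∈ G) (h' : eq t' u' ∈ G) :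
    eq (add t t') (add u u') ∈ G := by
  have h₁ := hG.instN_congr h (eq (add t t').shift (add (var 0) t'.shift))
  have h₂ := hG.instN_congr h' (eq (add t t').shift (add u.shift (var 0)))
  simp only [instN, Fml.subst, NTerm.subst, subst_shift_scons, scons] at h₁ h₂
  exact h₂ (h₁ (hG.eq_refl _))

theorem mul_congr {t u t' u' : NTerm} (h : eq t u ∈ G) (h' : eq t' u' ∈ G) :
    eq (mul t t') (mul u u') ∈ G := by
  have h₁ := hG.instN_congr h (eq (mul t t').shift (mul (var 0) t'.shift))
  have h₂ := hG.instN_congr h' (eq (mul t t').shift (mul u.shift (var 0)))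
  simp only [instN, Fml.subst, NTerm.subst, subst_shift_scons, scons] at h₁ h₂
  exact h₂ (h₁ (hG.eq_refl _))

theorem le_congr {t u t' u' : NTerm} (h : eq t u ∈ G) (h' : eq t' u' ∈ G)
    (hle : le t t' ∈ G) : le u u' ∈ G := by
  have h₁ := hG.instN_congr h (le (var 0) t'.shift)
  have h₂ := hG.instN_congr h' (le u.shift (var 0))
  simp only [instN, Fml.subst, NTerm.subst, subst_shift_scons, scons] at h₁ h₂
  exact h₂ (h₁ hle)

theorem mem_congr {t u : NTerm} (h : eq t u ∈ G) (X : ℕ) (hm : mem t X ∈ G) : mem u X ∈ G := by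
  have h₁ := hG.instN_congr h (mem (var 0) X)
  simp only [instN, Fml.subst, NTerm.subst, scons, id] at h₁
  exact h₁ hm

/-- Equality of terms in a Henkin set. -/
def setoid : Setoid NTerm where
  r t u := eq t u ∈ G
  iseqv := ⟨hG.eq_refl, hG.eq_symm, hG.eq_trans⟩

end IsHenkin

open IsHenkin in
/-- Completeness: a formula that holds in all structures satisfying `T` is provable from `T`. -/
theorem proves_of_forall_sat {T : Set Fml} {φ : Fml}
    (h : ∀ (N S : Type) [Zero N] [One N] [Add N] [Mul N] [LE N] (E : N → S → Prop),
      (∀ ψ ∈ T, ∀ v s, ψ.Sat E v s) → ∀ v s, φ.Sat E v s) : Proves T φ := by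
  by_contra hφ
  obtain ⟨G, hG, hneg⟩ := exists_isHenkin (T := T) (Γ := [neg φ]) fun h => hφ (.raa h)
  -- The term model: numbers are terms modulo provable equality in `G`, and the sets are the set
  -- variables themselves.
  let N := Quotient hG.setoid
  let q : NTerm → N := Quotient.mk hG.setoid
  let _ : Zero N := ⟨q .zero⟩
  let _ : One N := ⟨q .one⟩
  let _ : Add N := ⟨Quotient.map₂ NTerm.add fun _ _ h _ _ h' => hG.add_congr h h'⟩
  let _ : Mul N := ⟨Quotient.map₂ NTerm.mul fun _ _ h _ _ h' => hG.mul_congr h h'⟩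
  let _ : LE N := ⟨Quotient.lift₂ (fun t u => Fml.le t u ∈ G) fun _ _ _ _ h h' => propext
    ⟨hG.le_congr h h', hG.le_congr (hG.eq_symm h) (hG.eq_symm h')⟩⟩
  let E : N → ℕ → Prop := fun x X => Quotient.lift (fun t => Fml.mem t X ∈ G)
    (fun _ _ h => propext ⟨hG.mem_congr h X, hG.mem_congr (hG.eq_symm h) X⟩) x
  have heval (σ : ℕ → NTerm) (t : NTerm) : t.eval (fun n => q (σ n)) = q (t.subst σ) := by
    induction t with
    | var n => rfl
    | zero => rfl
    | one => rfl
    | add t u iht ihu => rw [NTerm.eval, iht, ihu]; rfl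
    | mul t u iht ihu => rw [NTerm.eval, iht, ihu]; rfl
  -- Truth lemma: an assignment by classes of terms acts like a substitution.
  have hsat (ψ : Fml) : ∀ (σ : ℕ → NTerm) (τ : ℕ → ℕ),
      ψ.Sat E (fun n => q (σ n)) τ ↔ ψ.subst σ τ ∈ G := by
    induction ψ with
    | eq t u =>
      intro σ τ
      rw [Fml.Sat, heval, heval]
      exact Quotient.eq (r := hG.setoid)
    | le t u => intro σ τ; rw [Fml.Sat, heval, heval]; rfl
    | mem t X => intro σ τ; rw [Fml.Sat, heval]; rfl
    | fal => intro σ τ; exact iff_of_false id hG.fal_notMem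
    | imp φ ψ ihφ ihψ =>
      intro σ τ
      rw [Fml.Sat, ihφ, ihψ, Fml.subst, hG.imp_mem_iff]
    | allN φ ih =>
      intro σ τ
      have e (t : NTerm) : scons (q t) (fun n => q (σ n)) = fun n => q (scons t σ n) := by
        funext n; cases n <;> rfl
      have e' (t : NTerm) : (φ.subst (liftN σ) τ).instN t = φ.subst (scons t σ) τ := by
        rw [instN, Fml.subst_subst]
        refine congrArg (fun σ => φ.subst σ τ) (funext fun n => ?_)
        cases n with
        | zero => rfl
        | succ n => exact subst_shift_scons t (σ n)
      rw [Fml.Sat, Fml.subst_allN, hG.allN_mem_iff, Quotient.mk_surjective.forall]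
      refine forall_congr' fun t => ?_
      rw [e', ← ih, ← e]
    | allS φ ih =>
      intro σ τ
      have e' (k : ℕ) : (φ.subst σ (liftS τ)).instS k = φ.subst σ (scons k τ) := by
        rw [instS, Fml.subst_subst]
        refine congrArg₂ (fun σ τ => φ.subst σ τ) (funext fun n => (σ n).subst_var)
          (funext fun n => ?_)
        cases n <;> rfl
      rw [Fml.Sat, Fml.subst_allS, hG.allS_mem_iff]
      refine forall_congr' fun k => ?_
      rw [e', ← ih]
  -- Each assignment is induced by a substitution of representatives, so the axioms hold under all
  -- assignments.
  have hT (ψ : Fml) (hψ : ψ ∈ T) (v : ℕ → N) (s : ℕ → ℕ) : ψ.Sat E v s := by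
    have : v = fun n => q ((v n).out) := funext fun n => (Quotient.out_eq _).symm
    rw [this, hsat]
    exact hG.thm (Prf.subst_nil (.ax hψ) _ _)
  have := (hsat φ var id).1 (h N ℕ E hT _ _)
  rw [subst_var_id] at this
  exact (hG.neg_mem_iff φ).1 (hneg _ (by simp)) this

/-! ### Satisfaction of compound formulas -/

section SatLemmas

variable {N S : Type} [Zero N] [One N] [Add N] [Mul N] [LE N]
  (E : N → S → Prop) (v : ℕ → N) (s : ℕ → S)

theorem scons_zero {α : Type} (a : α) (f : ℕ → α) : scons a f 0 = a := rfl

theorem sat_neg (φ : Fml) : (neg φ).Sat E v s ↔ ¬ φ.Sat E v s := Iff.rfl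

theorem sat_and (φ ψ : Fml) : (Fml.and φ ψ).Sat E v s ↔ φ.Sat E v s ∧ ψ.Sat E v s := by
  simp only [Fml.and, neg, Fml.Sat]; tauto

theorem sat_or (φ ψ : Fml) : (Fml.or φ ψ).Sat E v s ↔ φ.Sat E v s ∨ ψ.Sat E v s := by
  simp only [Fml.or, neg, Fml.Sat]; tauto

theorem sat_iff (φ ψ : Fml) : (Fml.iff φ ψ).Sat E v s ↔ (φ.Sat E v s ↔ ψ.Sat E v s) := by
  simp only [Fml.iff, sat_and, Fml.Sat]; tauto

theorem sat_exN (φ : Fml) : (exN φ).Sat E v s ↔ ∃ x, φ.Sat E (scons x v) s := by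
  simp only [exN, neg, Fml.Sat, imp_false, not_forall, not_not]

theorem sat_exS (φ : Fml) : (exS φ).Sat E v s ↔ ∃ X, φ.Sat E v (scons X s) := by
  simp only [exS, neg, Fml.Sat, imp_false, not_forall, not_not]

theorem sat_ballN (t : NTerm) (φ : Fml) :
    (ballN t φ).Sat E v s ↔ ∀ x ≤ t.eval v, φ.Sat E (scons x v) s := by
  simp only [ballN, Fml.Sat, NTerm.eval_shift, NTerm.eval, scons_zero]

theorem sat_bexN (t : NTerm) (φ : Fml) :
    (bexN t φ).Sat E v s ↔ ∃ x ≤ t.eval v, φ.Sat E (scons x v) s := by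
  simp only [bexN, sat_exN, sat_and, Fml.Sat, NTerm.eval_shift, NTerm.eval, scons_zero]

end SatLemmas

theorem sat_lt {N S : Type} [Zero N] [One N] [Add N] [Mul N] [PartialOrder N]
    (E : N → S → Prop) (v : ℕ → N) (s : ℕ → S) (t u : NTerm) :
    (Fml.lt t u).Sat E v s ↔ t.eval v < u.eval v := by
  rw [Fml.lt, sat_and, sat_neg, lt_iff_le_and_ne]
  rfl

namespace IsDelta0

variable {φ ψ : Fml}

theorem neg (h : IsDelta0 φ) : IsDelta0 (Fml.neg φ) := .imp h .fal

theorem and (h : IsDelta0 φ) (h' : IsDelta0 ψ) : IsDelta0 (Fml.and φ ψ) := .neg (.imp h (.neg h'))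

theorem or (h : IsDelta0 φ) (h' : IsDelta0 ψ) : IsDelta0 (Fml.or φ ψ) := .imp (.neg h) h'

theorem iff (h : IsDelta0 φ) (h' : IsDelta0 ψ) : IsDelta0 (Fml.iff φ ψ) :=
  .and (.imp h h') (.imp h' h)

theorem lt (t u : NTerm) : IsDelta0 (Fml.lt t u) := .and (.le t u) (.neg (.eq t u))

theorem isSigma_one (h : IsDelta0 φ) : IsSigma 1 φ := .ofPi (.zero _ h)

end IsDelta0

/-! ### Divisibility and codes of finite sets -/

/-- `t` divides `u`. -/
def dvdF (t u : NTerm) : Fml := bexN u (eq (mul t.shift (var 0)) u.shift)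

/-- `x` belongs to the finite set with code `c, d`. -/
def codeMemF (x c d : NTerm) : Fml := dvdF (add one (mul (add x one) d)) c

theorem IsDelta0.dvdF (t u : NTerm) : IsDelta0 (dvdF t u) := .bex _ (.eq _ _)

theorem IsDelta0.codeMemF (x c d : NTerm) : IsDelta0 (codeMemF x c d) := .dvdF _ _

section Arithmetic

variable {N : Type} [CommSemiring N]

/-- `x` belongs to the finite set with code `c, d`. -/
def CodeMem (x c d : N) : Prop := 1 + (x + 1) * d ∣ c

/-- The code of a pair. -/
def pr (a b : N) : N := (a + b) * (a + b) + a

variable [LinearOrder N] [IsStrictOrderedRing N] [CanonicallyOrderedAdd N]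

theorem succ_le_of_lt (hone : ∀ x : N, 0 < x → 1 ≤ x) {a b : N} (h : a < b) : a + 1 ≤ b := by
  obtain ⟨k, rfl⟩ := exists_add_of_le h.le
  have := hone k (by rw [pos_iff_ne_zero]; rintro rfl; simp at h)
  gcongr

/-- The code lies in the interval from `(a + b)²` up to but excluding `(a + b + 1)²`, so it
determines `a + b`, and then `a`. -/
theorem pr_inj (hone : ∀ x : N, 0 < x → 1 ≤ x) {a b a' b' : N} (h : pr a b = pr a' b') :
    a = a' ∧ b = b' := by
  have key : ∀ {a b a' b' : N}, a + b + 1 ≤ a' + b' → pr a b < pr a' b' := by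
    intro a b a' b' h
    have h₁ : (a + b + 1) * (a + b + 1) ≤ (a' + b') * (a' + b') := mul_le_mul' h h
    have h₂ : (a + b + 1) * (a + b + 1) = pr a b + (a + b + b + 1) := by
      simp only [pr]; ring
    have h₃ : pr a b < pr a b + (a + b + b + 1) := by
      have : (0 : N) < a + b + b + 1 := by positivity
      exact lt_add_of_pos_right _ this
    exact (h₃.trans_le (h₂ ▸ h₁)).trans_le le_self_add
  have hs : a + b = a' + b' := by
    rcases lt_trichotomy (a + b) (a' + b') with h' | h' | h'
    · exact absurd h (key (succ_le_of_lt hone h')).ne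
    · exact h'
    · exact absurd h (key (succ_le_of_lt hone h')).ne'
  have ha : a = a' := by
    simp only [pr, hs] at h
    exact add_left_cancel h
  subst ha
  exact ⟨rfl, add_left_cancel hs⟩

/-- Replaces subtraction of multiples: comparing the two quotients either gives their difference or
forces `c = 0`. -/
theorem dvd_of_dvd_add {a b c : N} (h : a ∣ b + c) (hb : a ∣ b) : a ∣ c := by
  obtain ⟨m, rfl⟩ := hb
  obtain ⟨n, hn⟩ := h
  rcases le_total m n with h | h
  · obtain ⟨r, rfl⟩ := exists_add_of_le h
    rw [mul_add] at hn
    exact ⟨r, add_left_cancel hn⟩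
  · have h₁ : a * n ≤ a * m := mul_le_mul_right h a
    have : c = 0 := by
      have : a * m + c ≤ a * m + 0 := by rw [hn, add_zero]; exact h₁
      simpa using this
    exact this ▸ dvd_zero a

/-- `d` is positive and divisible by all positive numbers up to `a`. -/
def IsMultiple (d a : N) : Prop := 1 ≤ d ∧ ∀ k ≤ a, 1 ≤ k → k ∣ d

/-- Write `m_x` for the modulus of `x`. Then `(y + 1) m_x` and `(x + 1) m_y` differ by `k = |x -
y|`, so `m_x ∣ c m_y` gives `m_x ∣ c k`. As `k ∣ d` and `(x + 1) d = m_x - 1`, the factor `k` can be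
removed. -/
theorem codeMem_of_mul {d a x y c : N} (hone : ∀ x : N, 0 < x → 1 ≤ x) (hd : IsMultiple d a)
    (hx : x ≤ a) (hy : y ≤ a) (hxy : x ≠ y) (h : CodeMem x (c * (1 + (y + 1) * d)) d) :
    CodeMem x c d := by
  unfold CodeMem at *
  have finish (k : N) (hk : k ∣ d) (h : 1 + (x + 1) * d ∣ c * k) : 1 + (x + 1) * d ∣ c := by
    obtain ⟨e, rfl⟩ := hk
    refine dvd_of_dvd_add (b := c * k * ((x + 1) * e)) ?_ (h.mul_right _)
    exact ⟨c, by ring⟩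
  have hle : ∀ {u w k : N}, u + k = w → k ≤ w := fun h => h ▸ le_add_self
  rcases lt_or_gt_of_ne hxy with hlt | hlt
  · obtain ⟨k, hk⟩ := exists_add_of_le hlt.le
    have hk1 : 1 ≤ k := hone k (by rw [pos_iff_ne_zero]; rintro rfl; simp [hk] at hlt)
    refine finish k (hd.2 k ((hle hk.symm).trans hy) hk1)
      (dvd_of_dvd_add (b := c * (1 + (y + 1) * d) * (x + 1)) ?_ (h.mul_right _))
    exact ⟨c * (y + 1), by subst hk; ring⟩
  · obtain ⟨k, hk⟩ := exists_add_of_le hlt.le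
    have hk1 : 1 ≤ k := hone k (by rw [pos_iff_ne_zero]; rintro rfl; simp [hk] at hlt)
    refine finish k (hd.2 k ((hle hk.symm).trans hx) hk1)
      (dvd_of_dvd_add (b := (1 + (x + 1) * d) * (c * (y + 1))) ?_ (dvd_mul_right _ _))
    have : (1 + (x + 1) * d) * (c * (y + 1)) + c * k = c * (1 + (y + 1) * d) * (x + 1) := by
      subst hk; ring
    rw [this]
    exact h.mul_right _

theorem one_lt_modulus {d : N} (hd : 1 ≤ d) (x : N) : 1 < 1 + (x + 1) * d := by
  have : 0 < (x + 1) * d := mul_pos (by positivity) (zero_lt_one.trans_le hd)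
  exact lt_add_of_pos_right _ this

theorem not_codeMem_one (hone : ∀ x : N, 0 < x → 1 ≤ x) {d x : N} (hd : 1 ≤ d) :
    ¬ CodeMem x 1 d := by
  rintro ⟨e, he⟩
  have : e ≠ 0 := by rintro rfl; simp at he
  have h := le_mul_of_one_le_right (zero_le (a := 1 + (x + 1) * d))
    (hone e (pos_iff_ne_zero.2 this))
  exact absurd (one_lt_modulus hd x) (not_lt.2 (h.trans_eq he.symm))

end Arithmetic

/-! ### Satisfaction of divisibility and code membership -/

section Sat

variable {N S : Type} [CommSemiring N] [LinearOrder N] [IsStrictOrderedRing N]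
  [CanonicallyOrderedAdd N] (E : N → S → Prop) (v : ℕ → N) (s : ℕ → S)

theorem sat_dvdF (hone : ∀ x : N, 0 < x → 1 ≤ x) (t u : NTerm) :
    (dvdF t u).Sat E v s ↔ t.eval v ∣ u.eval v := by
  simp only [dvdF, sat_bexN, Fml.Sat, NTerm.eval, NTerm.eval_shift, scons_zero]
  constructor
  · rintro ⟨e, -, he⟩
    exact ⟨e, he.symm⟩
  · rintro ⟨e, he⟩
    -- The quotient must respect the bound `u`. For divisor `0` the given quotient may be too large
    -- and is replaced by `0`.
    rcases eq_or_ne (t.eval v) 0 with h | h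
    · exact ⟨0, zero_le, by simp [he, h]⟩
    · refine ⟨e, ?_, he.symm⟩
      rw [he]
      exact le_mul_of_one_le_left zero_le (hone _ (pos_iff_ne_zero.2 h))

omit [LinearOrder N] [IsStrictOrderedRing N] [CanonicallyOrderedAdd N] in
theorem eval_pair (t u : NTerm) : (pair t u).eval v = pr (t.eval v) (u.eval v) := rfl

theorem sat_codeMemF (hone : ∀ x : N, 0 < x → 1 ≤ x) (x c d : NTerm) :
    (codeMemF x c d).Sat E v s ↔ CodeMem (x.eval v) (c.eval v) (d.eval v) :=
  sat_dvdF E v s hone _ _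

end Sat

/-- A model of `RCA₀` with `Σ⁰₂` induction on top of the algebraic axioms. -/
structure IsModel {N S : Type} [CommSemiring N] [LinearOrder N] (E : N → S → Prop) : Prop where
  one_le : ∀ x : N, 0 < x → 1 ≤ x
  ind : ∀ φ, IsSigma 1 φ ∨ IsSigma 2 φ → ∀ v s, (indAxiom φ).Sat E v s
  compr : ∀ φ ψ, IsSigma 1 φ → IsSigma 1 ψ → ∀ v s, (comprAxiom φ ψ).Sat E v s

/-! ### Induction and comprehension inside a model -/

namespace IsModel

variable {N S : Type} [CommSemiring N] [LinearOrder N] {E : N → S → Prop} (hE : IsModel E)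

include hE

theorem induction {φ : Fml} (hφ : IsSigma 1 φ ∨ IsSigma 2 φ) (v : ℕ → N) (s : ℕ → S)
    (h0 : φ.Sat E (scons 0 v) s)
    (hs : ∀ x, φ.Sat E (scons x v) s → φ.Sat E (scons (x + 1) v) s) (x : N) :
    φ.Sat E (scons x v) s := by
  have e₀ : (fun n => (scons zero var n).eval v) = scons 0 v := by
    funext n; cases n <;> rfl
  have e₁ (x : N) : (fun n => (scons (add (var 0) one) (fun n => var (n + 1)) n).eval (scons x v))
      = scons (x + 1) v := by
    funext n; cases n <;> rfl
  have h := hE.ind φ hφ v s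
  simp only [indAxiom, Fml.Sat, sat_and, instN, atSucc, sat_subst, e₀, e₁, Function.comp_id] at h
  exact h ⟨h0, hs⟩ x

theorem comprehension {φ ψ : Fml} (hφ : IsSigma 1 φ) (hψ : IsSigma 1 ψ) (v : ℕ → N) (s : ℕ → S)
    (h : ∀ x, φ.Sat E (scons x v) s ↔ ¬ ψ.Sat E (scons x v) s) :
    ∃ X, ∀ x, E x X ↔ φ.Sat E (scons x v) s := by
  have e (X : S) : (scons X s ∘ fun n => n + 1) = s := rfl
  have h' := hE.compr φ ψ hφ hψ v s
  simp only [comprAxiom, Fml.Sat, sat_iff, sat_neg, sat_exS, shiftS, sat_subst, e, NTerm.eval,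
    scons_zero] at h'
  exact h' h

theorem comprehension_delta0 {φ : Fml} (hφ : IsDelta0 φ) (v : ℕ → N) (s : ℕ → S) :
    ∃ X, ∀ x, E x X ↔ φ.Sat E (scons x v) s :=
  hE.comprehension hφ.isSigma_one hφ.neg.isSigma_one v s fun _ => by simp [sat_neg]

theorem lt_succ_iff [IsStrictOrderedRing N] [CanonicallyOrderedAdd N] {x y : N} :
    x < y + 1 ↔ x ≤ y := by
  exact ⟨fun h => not_lt.1 fun h' => absurd h (not_lt.2 (succ_le_of_lt hE.one_le h')),
    fun h => h.trans_lt (lt_add_one y)⟩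

end IsModel

namespace IsModel

variable {N S : Type} [CommSemiring N] [LinearOrder N] [IsStrictOrderedRing N]
  [CanonicallyOrderedAdd N] {E : N → S → Prop} (hE : IsModel E)

/-! ### Existence of codes -/

include hE

theorem exists_isMultiple (s : ℕ → S) (a : N) : ∃ d : N, IsMultiple d a := by
  have h := hE.induction (φ := exN (Fml.and (le one (var 0))
    (ballN (var 1) (imp (le one (var 0)) (dvdF (var 0) (var 1))))))
    (.inl (.ex (IsDelta0.and (.le _ _) (.ball _ (.imp (.le _ _) (.dvdF _ _)))).isSigma_one))
    (fun _ => 0) s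
  simp only [sat_exN, sat_and, sat_ballN, sat_dvdF _ _ _ hE.one_le, Fml.Sat, NTerm.eval, scons] at h
  refine h ⟨1, le_rfl, fun k hk hk' => ?_⟩ ?_ a
  · exact absurd (hk'.trans hk) (not_le.2 zero_lt_one)
  · rintro x ⟨d, hd, h⟩
    refine ⟨d * (x + 1), ?_, fun k hk hk' => ?_⟩
    · exact one_le_mul hd le_add_self
    · rcases hk.lt_or_eq with hk | rfl
      · exact (h k (hE.lt_succ_iff.1 hk) hk').mul_right _
      · exact dvd_mul_left _ _

theorem exists_full_code (s : ℕ → S) (d a : N) : ∃ c : N, 1 ≤ c ∧ ∀ y ≤ a, CodeMem y c d := by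
  have h := hE.induction (φ := exN (Fml.and (le one (var 0))
    (ballN (var 1) (codeMemF (var 0) (var 1) (var 3)))))
    (.inl (.ex (IsDelta0.and (.le _ _) (.ball _ (.codeMemF _ _ _))).isSigma_one))
    (scons d fun _ => 0) s
  simp only [sat_exN, sat_and, sat_ballN, sat_codeMemF _ _ _ hE.one_le, Fml.Sat, NTerm.eval,
    scons] at h
  have hpos (x : N) : 1 ≤ 1 + (x + 1) * d := le_self_add
  refine h ⟨1 + (0 + 1) * d, hpos 0, fun y hy => ?_⟩ ?_ a
  · rw [le_zero_iff] at hy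
    exact hy ▸ dvd_rfl
  · rintro x ⟨c, hc, h⟩
    refine ⟨c * (1 + (x + 1 + 1) * d), one_le_mul hc (hpos _), fun y hy => ?_⟩
    rcases hy.lt_or_eq with hy | rfl
    · exact (h y (hE.lt_succ_iff.1 hy)).mul_right _
    · exact dvd_mul_left _ _

/-! ### Persistent colours and a minimal one among them -/

/-- There are a stage `b` and a finite set with a code which contains exactly those colours `x ≤ a`
that occur on pairs beyond every stage, while the other ones do not occur beyond `b`. -/
theorem exists_stage (s : ℕ → S) (a : N) (C : S) :
    ∃ b c d : N, ∀ x ≤ a,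
      (CodeMem x c d → ∀ b', ∃ i j, b' < i ∧ i < j ∧ E (pr (pr i j) x) C) ∧
      (¬ CodeMem x c d → ∀ i j, b < i → i < j → ¬ E (pr (pr i j) x) C) := by
  obtain ⟨d, hd⟩ := hE.exists_isMultiple s a
  obtain ⟨c₀, hc₀, hfull⟩ := hE.exists_full_code s d a
  -- The statement at `n`: some `b` and `c ≥ 1` satisfy `c + n ≤ c₀`, and every `x ≤ a` outside the
  -- code `c, d` does not occur beyond `b`. The guard `x ≤ a` sits in the matrix, so `x, i, j` form
  -- one universal block and the formula is Σ⁰₂ without any appeal to collection.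
  have h := hE.induction (φ := exN (exN (allN (allN (allN
    (Fml.and (le (add (var 3) (var 5)) (var 8)) (Fml.and (le one (var 3))
      (imp (le (var 2) (var 6)) (Fml.or (codeMemF (var 2) (var 3) (var 7))
        (imp (Fml.lt (var 4) (var 1)) (imp (Fml.lt (var 1) (var 0))
          (neg (mem (triple (var 1) (var 0) (var 2)) 0)))))))))))))
    (.inr (.ex (.ex (.ofPi (.all (.all (.all (.ofSigma (.zero _ (IsDelta0.and (.le _ _)
      (.and (.le _ _) (.imp (.le _ _) (.or (.codeMemF _ _ _)
        (.imp (.lt _ _) (.imp (.lt _ _) (.neg (.mem _ _)))))))))))))))))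
    (scons a (scons d (scons c₀ fun _ => 0))) (fun _ => C)
  simp only [sat_exN, sat_and, sat_or, sat_neg, sat_lt, triple, eval_pair,
    sat_codeMemF _ _ _ hE.one_le, Fml.Sat, NTerm.eval, scons] at h
  by_contra hcon
  push Not at hcon
  -- If no stage works, a non-persistent colour can always be removed, which makes `c` drop at least
  -- once per step. At `n = c₀` this contradicts `c ≥ 1`.
  have hall := h ⟨0, c₀, fun x i j => ⟨by simp, hc₀, fun hx => .inl (hfull x hx)⟩⟩ ?_ c₀
  · obtain ⟨b, c, h⟩ := hall
    obtain ⟨h₁, h₂, -⟩ := h 0 0 0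
    have : 1 + c₀ ≤ c₀ := (add_le_add_left h₂ c₀).trans h₁
    exact absurd this (not_le.2 (lt_add_of_pos_left _ zero_lt_one))
  · rintro n ⟨b, c, hbc⟩
    obtain ⟨hle, hc, -⟩ := hbc 0 0 0
    obtain ⟨x, hxa, hx⟩ := hcon b c d
    have hx : CodeMem x c d ∧ ∃ b', ∀ i j, b' < i → i < j → ¬ E (pr (pr i j) x) C := by
      by_cases hm : CodeMem x c d
      · refine ⟨hm, ?_⟩
        by_contra hno
        push Not at hno
        obtain ⟨hm', -⟩ := hx fun _ b' => by
          obtain ⟨i, j, h₁, h₂, h₃⟩ := hno b'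
          exact ⟨i, j, h₁, h₂, h₃⟩
        exact hm' hm
      · obtain ⟨-, i, j, h₁, h₂, h₃⟩ := hx fun h => absurd h hm
        obtain ⟨-, -, h₄⟩ := hbc x i j
        exact absurd h₃ (((h₄ hxa).resolve_left hm) h₁ h₂)
    obtain ⟨⟨c', rfl⟩, b', hb'⟩ := hx
    have hc' : c' ≠ 0 := by
      rintro rfl
      simp only [mul_zero] at hc
      exact absurd hc (not_le.2 zero_lt_one)
    have hlt : c' < (1 + (x + 1) * d) * c' :=
      lt_mul_of_one_lt_left (pos_iff_ne_zero.2 hc') (one_lt_modulus hd.1 x)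
    refine ⟨max b b', c', fun y i j => ⟨?_, hE.one_le _ (pos_iff_ne_zero.2 hc'), fun hy => ?_⟩⟩
    · have := succ_le_of_lt hE.one_le hlt
      calc c' + (n + 1) = c' + 1 + n := by ring
        _ ≤ (1 + (x + 1) * d) * c' + n := by gcongr
        _ ≤ c₀ := hle
    -- The modulus of `x` may still divide `c'`. This is harmless: `x` no longer occurs beyond `b'`,
    -- and only the decrease of `c` is counted.
    · rcases eq_or_ne y x with rfl | hyx
      · exact .inr fun h₁ h₂ => hb' i j ((le_max_right _ _).trans_lt h₁) h₂
      · obtain ⟨-, -, h₄⟩ := hbc y i j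
        refine (h₄ hy).imp (fun hm => ?_) fun h₄ h₁ h₂ => h₄ ((le_max_left _ _).trans_lt h₁) h₂
        exact codeMem_of_mul hE.one_le hd hy hxa hyx (mul_comm c' _ ▸ hm)

/-- A nonempty finite set with a code has a minimal element for a transitive, antisymmetric
relation. -/
theorem exists_minimal (s : ℕ → S) (a c d : N) (P R : S)
    (hanti : ∀ x y, E x P → E y P → E (pr x y) R → E (pr y x) R → x = y)
    (htrans : ∀ x y z, E x P → E y P → E z P → E (pr x y) R → E (pr y z) R → E (pr x z) R)
    (hne : ∃ p ≤ a, E p P ∧ CodeMem p c d) :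
    ∃ p ≤ a, E p P ∧ CodeMem p c d ∧
      ∀ q ≤ a, E q P → CodeMem q c d → E (pr q p) R → q = p := by
  -- Induction on `x`: some element `p` is minimal against all elements below `x`. In the step `p`
  -- is replaced by `x` exactly when `x` is an element with `x ⪯ p`.
  have h := hE.induction (φ := bexN (var 1) (Fml.and (mem (var 0) 0)
    (Fml.and (codeMemF (var 0) (var 3) (var 4)) (ballN (var 2) (imp (Fml.lt (var 0) (var 2))
      (imp (mem (var 0) 0) (imp (codeMemF (var 0) (var 4) (var 5))
        (imp (mem (pair (var 0) (var 1)) 1) (eq (var 0) (var 1))))))))))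
    (.inl (IsDelta0.bex _ (.and (.mem _ _) (.and (.codeMemF _ _ _) (.ball _ (.imp (.lt _ _)
      (.imp (.mem _ _) (.imp (.codeMemF _ _ _) (.imp (.mem _ _) (.eq _ _))))))))).isSigma_one)
    (scons a (scons c (scons d fun _ => 0))) (scons P (scons R s))
  simp only [sat_bexN, sat_ballN, sat_and, sat_lt, eval_pair,
    sat_codeMemF _ _ _ hE.one_le, Fml.Sat, NTerm.eval, scons] at h
  obtain ⟨p, hpa, hpP, hpc⟩ := hne
  have hall := h ⟨p, hpa, hpP, hpc, fun q _ hq => absurd hq not_lt_zero⟩ ?_ (a + 1)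
  · obtain ⟨p, hpa, hpP, hpc, hp⟩ := hall
    exact ⟨p, hpa, hpP, hpc, fun q hq => hp q hq (hE.lt_succ_iff.2 hq)⟩
  · rintro x ⟨p, hpa, hpP, hpc, hp⟩
    by_cases hx : x ≤ a ∧ E x P ∧ CodeMem x c d ∧ E (pr x p) R
    · obtain ⟨hxa, hxP, hxc, hxp⟩ := hx
      refine ⟨x, hxa, hxP, hxc, fun q hqa hqx hqP hqc hqxR => ?_⟩
      rcases (hE.lt_succ_iff.1 hqx).lt_or_eq with hlt | rfl
      · have := hp q hqa hlt hqP hqc (htrans q x p hqP hxP hpP hqxR hxp)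
        subst this
        exact hanti _ _ hqP hxP hqxR hxp
      · rfl
    · refine ⟨p, hpa, hpP, hpc, fun q hqa hqx hqP hqc hqp => ?_⟩
      rcases (hE.lt_succ_iff.1 hqx).lt_or_eq with hlt | rfl
      · exact hp q hqa hlt hqP hqc hqp
      · exact absurd ⟨hqa, hqP, hqc, hqp⟩ hx

end IsModel

/-! ### Greedy subsets -/

/-- The set with code `c, d` is, up to `z`, the greedy subset of the set variable `0` for the
compatibility relation given by the set variable `1`. -/
def greedyF (c d z : NTerm) : Fml :=
  ballN z (Fml.iff (codeMemF (var 0) c.shift d.shift) (Fml.and (mem (var 0) 0)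
    (ballN (var 0) (imp (Fml.lt (var 0) (var 1))
      (imp (codeMemF (var 0) c.shift.shift d.shift.shift) (mem (pair (var 0) (var 1)) 1))))))

theorem IsDelta0.greedyF (c d z : NTerm) : IsDelta0 (greedyF c d z) :=
  .ball _ (.iff (.codeMemF _ _ _) (.and (.mem _ _) (.ball _ (.imp (.lt _ _)
    (.imp (.codeMemF _ _ _) (.mem _ _))))))

namespace IsModel

variable {N S : Type} [CommSemiring N] [LinearOrder N] [IsStrictOrderedRing N]
  [CanonicallyOrderedAdd N] {E : N → S → Prop} (hE : IsModel E)

/-- The set with code `c, d` is, up to `z`, the greedy subset of `A` for the compatibility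
relation `B`. -/
def Greedy (E : N → S → Prop) (A B : S) (c d z : N) : Prop :=
  ∀ y ≤ z, (CodeMem y c d ↔ E y A ∧ ∀ e ≤ y, e < y → CodeMem e c d → E (pr e y) B)

include hE

theorem sat_greedyF (v : ℕ → N) (s : ℕ → S) (c d z : NTerm) :
    (greedyF c d z).Sat E v s ↔ Greedy E (s 0) (s 1) (c.eval v) (d.eval v) (z.eval v) := by
  simp only [greedyF, sat_ballN, sat_and, sat_iff, sat_lt, eval_pair, NTerm.eval_shift,
    sat_codeMemF _ _ _ hE.one_le, Fml.Sat, NTerm.eval, scons, Greedy]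

theorem exists_greedy_code (s : ℕ → S) (A B : S) (z : N) : ∃ c d, Greedy E A B c d z := by
  obtain ⟨d, hd⟩ := hE.exists_isMultiple s z
  -- At `x` the code contains exactly the greedy elements below `x` among the numbers up to `z`. An
  -- accepted `x` is added by multiplying with its modulus.
  have h := hE.induction (φ := exN (ballN (var 2)
    (Fml.iff (codeMemF (var 0) (var 1) (var 4)) (Fml.and (Fml.lt (var 0) (var 2))
      (Fml.and (mem (var 0) 0) (ballN (var 0) (imp (Fml.lt (var 0) (var 1))
        (imp (codeMemF (var 0) (var 2) (var 5)) (mem (pair (var 0) (var 1)) 1)))))))))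
    (.inl (.ex (IsDelta0.ball _ (.iff (.codeMemF _ _ _) (.and (.lt _ _) (.and (.mem _ _)
      (.ball _ (.imp (.lt _ _) (.imp (.codeMemF _ _ _) (.mem _ _)))))))).isSigma_one))
    (scons z (scons d fun _ => 0)) (scons A (scons B s))
  simp only [sat_exN, sat_ballN, sat_and, sat_iff, sat_lt, eval_pair,
    sat_codeMemF _ _ _ hE.one_le, Fml.Sat, NTerm.eval, scons] at h
  have hall := h ⟨1, fun y _ => iff_of_false (not_codeMem_one hE.one_le hd.1)
    fun h => not_lt_zero h.1⟩ ?_ (z + 1)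
  · obtain ⟨c, hc⟩ := hall
    refine ⟨c, d, fun y hy => ?_⟩
    rw [hc y hy]
    exact and_iff_right (hE.lt_succ_iff.2 hy)
  · rintro x ⟨c, hc⟩
    by_cases hx : x ≤ z ∧ E x A ∧ ∀ e ≤ x, e < x → CodeMem e c d → E (pr e x) B
    · obtain ⟨hxz, hxA, hxB⟩ := hx
      have hmem (y : N) (hy : y ≤ z) (hyx : y ≠ x) :
          CodeMem y (c * (1 + (x + 1) * d)) d ↔ CodeMem y c d :=
        ⟨codeMem_of_mul hE.one_le hd hy hxz hyx, fun h => h.mul_right _⟩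
      refine ⟨c * (1 + (x + 1) * d), fun y hy => ?_⟩
      have hbelow (hyx : y ≤ x) : (∀ e ≤ y, e < y → CodeMem e (c * (1 + (x + 1) * d)) d →
          E (pr e y) B) ↔ ∀ e ≤ y, e < y → CodeMem e c d → E (pr e y) B :=
        forall₃_congr fun e he he' => by rw [hmem e (he.trans hy) (he'.trans_le hyx).ne]
      rcases lt_trichotomy y x with hlt | rfl | hlt
      · rw [hmem y hy hlt.ne, hc y hy, hbelow hlt.le]
        simp [hlt, hE.lt_succ_iff, hlt.le]
      · exact iff_of_true (dvd_mul_left _ _) ⟨lt_add_one y, hxA, (hbelow le_rfl).2 hxB⟩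
      · rw [hmem y hy hlt.ne', hc y hy]
        exact iff_of_false (fun h => h.1.not_gt hlt)
          fun h => (hE.lt_succ_iff.1 h.1).not_gt hlt
    · refine ⟨c, fun y hy => ?_⟩
      rw [hc y hy]
      refine ⟨fun h => ⟨h.1.trans (lt_add_one x), h.2⟩, fun h => ⟨?_, h.2⟩⟩
      refine (hE.lt_succ_iff.1 h.1).lt_of_ne ?_
      rintro rfl
      exact hx ⟨hy, h.2⟩

/-- Course-of-values induction: membership of `y` depends only on membership of smaller numbers. -/
theorem greedy_unique (s : ℕ → S) {A B : S} {c d z c' d' z' : N} (h : Greedy E A B c d z)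
    (h' : Greedy E A B c' d' z') {y : N} (hy : y ≤ z) (hy' : y ≤ z') :
    CodeMem y c d ↔ CodeMem y c' d' := by
  have hi := hE.induction (φ := ballN (var 0) (imp (Fml.lt (var 0) (var 1))
      (imp (le (var 0) (var 2)) (imp (le (var 0) (var 3))
        (Fml.iff (codeMemF (var 0) (var 4) (var 5)) (codeMemF (var 0) (var 6) (var 7)))))))
    (.inl (IsDelta0.ball _ (.imp (.lt _ _) (.imp (.le _ _) (.imp (.le _ _)
      (.iff (.codeMemF _ _ _) (.codeMemF _ _ _)))))).isSigma_one)
    (scons z (scons z' (scons c (scons d (scons c' (scons d' fun _ => 0)))))) s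
  simp only [sat_ballN, sat_iff, sat_lt, sat_codeMemF _ _ _ hE.one_le, Fml.Sat, NTerm.eval,
    scons] at hi
  refine hi (fun y _ hy => absurd hy not_lt_zero) (fun x ih y _ hyx hyz hyz' => ?_) (y + 1) y
    le_self_add (lt_add_one y) hy hy'
  rw [h y hyz, h' y hyz']
  refine and_congr_right fun _ => forall₃_congr fun e he he' => ?_
  have hex := he'.trans_le (hE.lt_succ_iff.1 hyx)
  rw [ih e hex.le hex (he.trans hyz) (he.trans hyz')]

/-- The greedy subset of `A` for the compatibility relation `B` exists. -/
theorem exists_greedy_set (s : ℕ → S) (A B : S) :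
    ∃ Z, ∀ y, E y Z ↔ E y A ∧ ∀ e < y, E e Z → E (pr e y) B := by
  -- Codes of initial segments exist and agree where they overlap, so "some code accepts `y`" and
  -- "some code rejects `y`" are complementary Σ⁰₁ conditions.
  obtain ⟨Z, hZ⟩ := hE.comprehension
    (φ := exN (exN (Fml.and (greedyF (var 1) (var 0) (var 2)) (codeMemF (var 2) (var 1) (var 0)))))
    (ψ := exN (exN (Fml.and (greedyF (var 1) (var 0) (var 2))
      (neg (codeMemF (var 2) (var 1) (var 0))))))
    (.ex (.ex (IsDelta0.and (.greedyF _ _ _) (.codeMemF _ _ _)).isSigma_one))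
    (.ex (.ex (IsDelta0.and (.greedyF _ _ _) (.neg (.codeMemF _ _ _))).isSigma_one))
    (fun _ => 0) (scons A (scons B s)) (by
      intro y
      simp only [sat_exN, sat_and, sat_neg, hE.sat_greedyF, sat_codeMemF _ _ _ hE.one_le,
        NTerm.eval, scons]
      constructor
      · rintro ⟨c, d, h, hy⟩ ⟨c', d', h', hy'⟩
        exact hy' ((hE.greedy_unique s h h' le_rfl le_rfl).1 hy)
      · intro h
        obtain ⟨c, d, hg⟩ := hE.exists_greedy_code s A B y
        exact ⟨c, d, hg, by_contra fun hy => h ⟨c, d, hg, hy⟩⟩)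
  simp only [sat_exN, sat_and, hE.sat_greedyF, sat_codeMemF _ _ _ hE.one_le,
        NTerm.eval, scons] at hZ
  refine ⟨Z, fun y => ?_⟩
  obtain ⟨c, d, hg⟩ := hE.exists_greedy_code s A B y
  have hmem (e : N) (he : e ≤ y) : E e Z ↔ CodeMem e c d := by
    rw [hZ]
    constructor
    · rintro ⟨c', d', h', he'⟩
      exact (hE.greedy_unique s h' hg le_rfl he).1 he'
    · exact fun h => ⟨c, d, fun x hx => hg x (hx.trans he), h⟩
  rw [hmem y le_rfl, hg y le_rfl]
  refine and_congr_right fun _ => ⟨fun h e he hez => h e he.le he ((hmem e he.le).1 hez),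
    fun h e he he' hec => h e he' ((hmem e he).2 hec)⟩

/-! ### Separated pairs and the homogeneous set -/

omit hE [IsStrictOrderedRing N] in
theorem le_pr_left (a b : N) : a ≤ pr a b := le_add_self

theorem le_pr_right (a b : N) : b ≤ pr a b := by
  rcases eq_or_ne (a + b) 0 with h | h
  · have : b ≤ a + b := le_add_self
    exact this.trans (h ▸ zero_le)
  · calc b ≤ a + b := le_add_self
      _ ≤ (a + b) * (a + b) := le_mul_of_one_le_left zero_le (hE.one_le _ (pos_iff_ne_zero.2 h))
      _ ≤ pr a b := le_self_add

/-- There is a set of pairs `i < j` from `A` which lie one after the other. -/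
theorem exists_separated_pairs (s : ℕ → S) (A : S)
    (hA : ∀ m, ∃ i j, m < i ∧ i < j ∧ E (pr i j) A) :
    ∃ Z, (∀ i j, E (pr i j) Z → i < j ∧ E (pr i j) A) ∧ (∀ m, ∃ i j, m ≤ i ∧ E (pr i j) Z) ∧
      ∀ i j i' j', E (pr i j) Z → E (pr i' j') Z → (i = i' ∧ j = j') ∨ j < i' ∨ j' < i := by
  -- The greedy construction is applied to the codes of pairs `i < j` in `A`, with `(i, j)`
  -- compatible with a later-coded `(i', j')` when `j < i'`.
  obtain ⟨A', hA'⟩ := hE.comprehension_delta0 (φ := bexN (var 0) (bexN (var 1)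
    (Fml.and (eq (var 2) (pair (var 1) (var 0))) (Fml.and (Fml.lt (var 1) (var 0))
      (mem (var 2) 0)))))
    (.bex _ (.bex _ (.and (.eq _ _) (.and (.lt _ _) (.mem _ _))))) (fun _ => 0) (fun _ => A)
  obtain ⟨B, hB⟩ := hE.comprehension_delta0 (φ := bexN (var 0) (bexN (var 1) (bexN (var 2)
    (bexN (var 3) (Fml.and (Fml.lt (var 2) (var 1))
      (eq (var 4) (pair (pair (var 3) (var 2)) (pair (var 1) (var 0)))))))))
    (.bex _ (.bex _ (.bex _ (.bex _ (.and (.lt _ _) (.eq _ _)))))) (fun _ => 0) (fun _ => A)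
  simp only [sat_bexN, sat_and, sat_lt, eval_pair, Fml.Sat, NTerm.eval, scons] at hA' hB
  have hpair (z : N) (h : E z A') : ∃ i j, z = pr i j := by
    obtain ⟨i, -, j, -, h, -⟩ := (hA' z).1 h
    exact ⟨i, j, h⟩
  replace hA' (i j : N) : E (pr i j) A' ↔ i < j ∧ E (pr i j) A := by
    rw [hA']
    constructor
    · rintro ⟨i', -, j', -, h, h₁, h₂⟩
      obtain ⟨rfl, rfl⟩ := pr_inj hE.one_le h
      exact ⟨h₁, h₂⟩
    · exact fun h => ⟨i, le_pr_left i j, j, hE.le_pr_right i j, rfl, h⟩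
  replace hB (i j i' j' : N) : E (pr (pr i j) (pr i' j')) B ↔ j < i' := by
    rw [hB]
    constructor
    · rintro ⟨i₁, -, j₁, -, i₂, -, j₂, -, h₁, h⟩
      obtain ⟨h₂, h₃⟩ := pr_inj hE.one_le h
      obtain ⟨rfl, rfl⟩ := pr_inj hE.one_le h₂
      obtain ⟨rfl, rfl⟩ := pr_inj hE.one_le h₃
      exact h₁
    · have h₁ := le_pr_left (pr i j) (pr i' j')
      have h₂ := hE.le_pr_right (pr i j) (pr i' j')
      exact fun h => ⟨i, (le_pr_left i j).trans h₁, j, (hE.le_pr_right i j).trans h₁,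
        i', (le_pr_left i' j').trans h₂, j', (hE.le_pr_right i' j').trans h₂, h, rfl⟩
  obtain ⟨Z, hZ⟩ := hE.exists_greedy_set s A' B
  have hsep (i j i' j' : N) (h : E (pr i j) Z) (h' : E (pr i' j') Z) :
      (i = i' ∧ j = j') ∨ j < i' ∨ j' < i := by
    rcases lt_trichotomy (pr i j) (pr i' j') with hlt | heq | hlt
    · exact .inr (.inl ((hB _ _ _ _).1 (((hZ _).1 h').2 _ hlt h)))
    · exact .inl (pr_inj hE.one_le heq)
    · exact .inr (.inr ((hB _ _ _ _).1 (((hZ _).1 h).2 _ hlt h')))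
  have hsub (i j : N) (h : E (pr i j) Z) : i < j ∧ E (pr i j) A := (hA' i j).1 ((hZ _).1 h).1
  -- A pair of `A` is either chosen or rejected because of a chosen pair that does not end before it
  -- starts.
  have hnext (i j : N) (hij : i < j) (h : E (pr i j) A) :
      ∃ i' j', E (pr i' j') Z ∧ i ≤ j' := by
    by_cases hz : E (pr i j) Z
    · exact ⟨i, j, hz, hij.le⟩
    · have := mt (hZ (pr i j)).2 hz
      push Not at this
      obtain ⟨e, -, heZ, he⟩ := this ((hA' i j).2 ⟨hij, h⟩)
      obtain ⟨i', j', rfl⟩ := hpair e ((hZ e).1 heZ).1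
      rw [hB, not_lt] at he
      exact ⟨i', j', heZ, he⟩
  refine ⟨Z, hsub, ?_, hsep⟩
  have hi := hE.induction
    (φ := exN (exN (Fml.and (le (var 2) (var 1)) (mem (pair (var 1) (var 0)) 0))))
    (.inl (.ex (.ex (IsDelta0.and (.le _ _) (.mem _ _)).isSigma_one))) (fun _ => 0) (fun _ => Z)
  simp only [sat_exN, sat_and, eval_pair, Fml.Sat, NTerm.eval, scons] at hi
  refine hi ?_ ?_
  · obtain ⟨i, j, -, hij, h⟩ := hA 0
    obtain ⟨i', j', h', -⟩ := hnext i j hij h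
    exact ⟨i', j', zero_le, h'⟩
  · rintro m ⟨i, j, hmi, h⟩
    -- Applying `hnext` to a pair starting after `j` gives a chosen pair with `j < j'`. By
    -- separation it starts after `j`, hence beyond `m`.
    obtain ⟨i₁, j₁, hlt, hij₁, h₁⟩ := hA j
    obtain ⟨i', j', h', hle⟩ := hnext i₁ j₁ hij₁ h₁
    have hij := (hsub i j h).1
    have hij' := (hsub i' j' h').1
    refine ⟨i', j', succ_le_of_lt hE.one_le ?_, h'⟩
    rcases hsep i j i' j' h h' with ⟨rfl, rfl⟩ | h | h <;> order

omit [CanonicallyOrderedAdd N] in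
/-- The set of first components of a set of separated pairs exists. -/
theorem exists_first_components (Z : S) (hZ : ∀ i j, E (pr i j) Z → i < j)
    (hinf : ∀ m, ∃ i j, m ≤ i ∧ E (pr i j) Z)
    (hsep : ∀ i j i' j', E (pr i j) Z → E (pr i' j') Z → (i = i' ∧ j = j') ∨ j < i' ∨ j' < i) :
    ∃ I, ∀ i, E i I ↔ ∃ j, E (pr i j) Z := by
  -- Non-membership is also Σ⁰₁: take a chosen pair starting at some `i' > i`. By separation a
  -- chosen pair `(i, j)` would satisfy `j < i'`, so a bounded search decides whether it exists.
  obtain ⟨I, hI⟩ := hE.comprehension (φ := exN (mem (pair (var 1) (var 0)) 0))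
    (ψ := exN (exN (Fml.and (mem (pair (var 1) (var 0)) 0) (Fml.and (Fml.lt (var 2) (var 1))
      (ballN (var 0) (neg (mem (pair (var 3) (var 0)) 0)))))))
    (.ex (IsDelta0.mem _ _).isSigma_one)
    (.ex (.ex (IsDelta0.and (.mem _ _) (.and (.lt _ _) (.ball _ (.neg (.mem _ _))))).isSigma_one))
    (fun _ => 0) (fun _ => Z) (by
      intro i
      simp only [sat_exN, sat_ballN, sat_and, sat_neg, sat_lt, eval_pair, Fml.Sat, NTerm.eval,
        scons]
      constructor
      · rintro ⟨j, h⟩ ⟨i', j', h', hlt, hno⟩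
        have h₁ := hZ i j h
        have h₂ := hZ i' j' h'
        refine hno j ?_ h
        rcases hsep i j i' j' h h' with ⟨rfl, rfl⟩ | h | h <;> order
      · intro h
        by_contra hno
        obtain ⟨i', j', hle, h'⟩ := hinf (i + 1)
        exact h ⟨i', j', h', (lt_add_one i).trans_le hle, fun j _ hj => hno ⟨j, hj⟩⟩)
  simp only [sat_exN, eval_pair, Fml.Sat, NTerm.eval, scons] at hI
  exact ⟨I, hI⟩

/-- Ordered Ramsey's Theorem for pairs holds in the model. -/
theorem exists_homogeneous (s : ℕ → S) (P R C : S) (hfin : ∃ a, ∀ x, E x P → x ≤ a)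
    (hanti : ∀ x y, E x P → E y P → E (pr x y) R → E (pr y x) R → x = y)
    (htrans : ∀ x y z, E x P → E y P → E z P → E (pr x y) R → E (pr y z) R → E (pr x z) R)
    (hcol : ∀ i j, i < j → ∃ p, E p P ∧ E (pr (pr i j) p) C ∧ ∀ q, E (pr (pr i j) q) C → q = p)
    (hord : ∀ i j k p q, i < j → j < k → E (pr (pr i j) p) C → E (pr (pr i k) q) C →
      E (pr q p) R) :
    ∃ I, (∀ m, ∃ i, m < i ∧ E i I) ∧
      ∃ p, ∀ i j q, E i I → E j I → i < j → E (pr (pr i j) q) C → q = p := by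
  obtain ⟨a, ha⟩ := hfin
  obtain ⟨b, c, d, hstage⟩ := hE.exists_stage s a C
  have hcode (i j p : N) (hi : b < i) (hij : i < j) (hp : E p P) (h : E (pr (pr i j) p) C) :
      CodeMem p c d :=
    by_contra fun hn => (hstage p (ha p hp)).2 hn i j hi hij h
  obtain ⟨p, hpa, hpP, hpc, hmin⟩ : ∃ p ≤ a, E p P ∧ CodeMem p c d ∧
      ∀ q ≤ a, E q P → CodeMem q c d → E (pr q p) R → q = p := by
    refine hE.exists_minimal s a c d P R hanti htrans ?_
    obtain ⟨p, hp, h, -⟩ := hcol (b + 1) (b + 1 + 1) (lt_add_one _)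
    exact ⟨p, ha p hp, hp, hcode _ _ p (lt_add_one b) (lt_add_one _) hp h⟩
  -- Past the stage `b` the colour `C(i, k) ⪯ p` lies in the coded set, so minimality of `p`
  -- prevents a further descent.
  have hstable (i j k q : N) (hi : b < i) (hij : i < j) (hjk : j < k)
      (h : E (pr (pr i j) p) C) (hq : E (pr (pr i k) q) C) : q = p := by
    obtain ⟨q', hq'P, hq', huniq⟩ := hcol i k (hij.trans hjk)
    obtain rfl := huniq q hq
    exact hmin q (ha q hq'P) hq'P (hcode i k q hi (hij.trans hjk) hq'P hq)
      (hord i j k p q hij hjk h hq)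
  obtain ⟨A, hA⟩ := hE.comprehension_delta0 (φ := bexN (var 0) (bexN (var 1)
    (Fml.and (Fml.lt (var 4) (var 1)) (Fml.and (eq (var 2) (pair (var 1) (var 0)))
      (mem (pair (var 2) (var 3)) 0)))))
    (.bex _ (.bex _ (.and (.lt _ _) (.and (.eq _ _) (.mem _ _)))))
    (scons p (scons b fun _ => 0)) (fun _ => C)
  simp only [sat_bexN, sat_and, sat_lt, eval_pair, Fml.Sat, NTerm.eval, scons] at hA
  replace hA (i j : N) : E (pr i j) A ↔ b < i ∧ E (pr (pr i j) p) C := by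
    rw [hA]
    constructor
    · rintro ⟨i', -, j', -, h₁, h, h₂⟩
      obtain ⟨rfl, rfl⟩ := pr_inj hE.one_le h
      exact ⟨h₁, h₂⟩
    · exact fun h => ⟨i, le_pr_left i j, j, hE.le_pr_right i j, h.1, rfl, h.2⟩
  obtain ⟨Z, hZA, hinf, hsep⟩ := hE.exists_separated_pairs s A (by
    intro m
    obtain ⟨i, j, hm, hij, h⟩ := (hstage p hpa).1 hpc (max m b)
    exact ⟨i, j, (le_max_left _ _).trans_lt hm, hij,
      (hA i j).2 ⟨(le_max_right _ _).trans_lt hm, h⟩⟩)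
  obtain ⟨I, hI⟩ := hE.exists_first_components Z (fun i j h => (hZA i j h).1) hinf hsep
  refine ⟨I, fun m => ?_, p, fun i i' q hi hi' hlt hq => ?_⟩
  · obtain ⟨i, j, hle, h⟩ := hinf (m + 1)
    exact ⟨i, (lt_add_one m).trans_le hle, (hI i).2 ⟨j, h⟩⟩
  · obtain ⟨j, hj⟩ := (hI i).1 hi
    obtain ⟨j', hj'⟩ := (hI i').1 hi'
    obtain ⟨hij, hjA⟩ := hZA i j hj
    obtain ⟨hij', -⟩ := hZA i' j' hj'
    obtain ⟨hb, hp⟩ := (hA i j).1 hjA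
    -- The partner `j` of `i` lies strictly between `i` and `i'`, so the colour `p` of `(i, j)`
    -- passes to `(i, i')`.
    refine hstable i j i' q hb hij ?_ hp hq
    rcases hsep i j i' j' hj hj' with ⟨rfl, rfl⟩ | h | h <;> order

theorem sat_orderedRamsey (v : ℕ → N) (s : ℕ → S) : orderedRamsey.Sat E v s := by
  simp only [orderedRamsey, finiteSet, partialOrderOn, colouring, orderedColouring, infiniteSet,
    homogeneous, sat_exN, sat_exS, sat_and, sat_lt, triple, eval_pair, Fml.Sat, NTerm.eval, scons]
  rintro P R C ⟨hfin, ⟨-, hanti, htrans⟩, hcol, hord⟩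
  obtain ⟨I, hinf, p, hp⟩ := hE.exists_homogeneous s P R C hfin hanti htrans hcol hord
  exact ⟨I, hinf, fun i j i' j' q q' hi hj hij hi' hj' hij' hq hq' =>
    (hp i j q hi hj hij hq).trans (hp i' j' q' hi' hj' hij' hq').symm⟩

end IsModel

/-! ### From the axioms to ordered semirings -/

theorem sat_orderedRamsey_of_sat {N S : Type} [Zero N] [One N] [Add N] [Mul N] [LE N]
    {E : N → S → Prop} (hT : ∀ ψ ∈ RCA0 ∪ SigmaIND 2, ∀ v s, ψ.Sat E v s) (v : ℕ → N)
    (s : ℕ → S) : orderedRamsey.Sat E v s := by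
  -- Three values cover the variables of every basic axiom; axioms with fewer variables receive
  -- dummy arguments below.
  have hax {ψ : Fml} (h : BasicAxiom ψ) (a b c : N) :
      ψ.Sat E (scons a (scons b (scons c v))) s := hT ψ (.inl (.inl (.inl h))) _ _
  have hadd_assoc := hax .add_assoc
  have hadd_comm := hax .add_comm
  have hadd_zero := hax .add_zero
  have hmul_assoc := hax .mul_assoc
  have hmul_comm := hax .mul_comm
  have hmul_one := hax .mul_one
  have hmul_zero := hax .mul_zero
  have hmul_add := hax .mul_add
  have hle_refl := hax .le_refl
  have hle_antisymm := hax .le_antisymm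
  have hle_trans := hax .le_trans
  have hle_total := hax .le_total
  have hadd_lt := hax .add_lt_add
  have hmul_lt := hax .mul_lt_mul
  have hzero_le := hax .zero_le
  have hzero_lt_one := hax .zero_lt_one
  have hdiscrete := hax .discrete
  have hsub := hax .subtraction
  simp only [Fml.lt, sat_and, sat_or, sat_neg, sat_exN, Fml.Sat, NTerm.eval, scons] at *
  let _ : CommSemiring N :=
    { add_assoc := hadd_assoc
      add_comm := fun a b => hadd_comm a b a
      add_zero := fun a => hadd_zero a a a
      zero_add := fun a => (hadd_comm 0 a a).trans (hadd_zero a a a)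
      mul_assoc := hmul_assoc
      mul_comm := fun a b => hmul_comm a b a
      mul_one := fun a => hmul_one a a a
      one_mul := fun a => (hmul_comm 1 a a).trans (hmul_one a a a)
      mul_zero := fun a => hmul_zero a a a
      zero_mul := fun a => (hmul_comm 0 a a).trans (hmul_zero a a a)
      left_distrib := hmul_add
      right_distrib := fun a b c => by
        rw [hmul_comm (a + b) c a, hmul_add, hmul_comm c a a, hmul_comm c b a]
      nsmul := nsmulRec }
  let _ : LinearOrder N :=
    { le_refl := fun a => hle_refl a a a
      le_trans := hle_trans
      le_antisymm := fun a b => hle_antisymm a b a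
      le_total := fun a b => hle_total a b a
      toDecidableLE := Classical.decRel _ }
  simp only [← ne_eq, ← lt_iff_le_and_ne] at hadd_lt hmul_lt hzero_lt_one hdiscrete
  have : IsStrictOrderedRing N :=
    { add_le_add_left := fun a b h c => by
        rcases h.lt_or_eq with h | rfl
        · exact (hadd_lt a b c h).le
        · exact le_rfl
      le_of_add_le_add_left := fun a b c h => by
        rw [add_comm a b, add_comm a c] at h
        exact not_lt.1 fun h' => (hadd_lt c b a h').not_ge h
      zero_le_one := (hzero_lt_one 0 0 0).le
      exists_pair_ne := ⟨0, 1, (hzero_lt_one 0 0 0).ne⟩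
      mul_lt_mul_of_pos_left := fun a h b c hbc => by
        simpa only [mul_comm] using hmul_lt b c a hbc h
      mul_lt_mul_of_pos_right := fun a h b c hbc => hmul_lt b c a hbc h }
  have : CanonicallyOrderedAdd N :=
    { exists_add_of_le := fun {a b} h => by
        obtain ⟨c, hc⟩ := hsub a b a h
        exact ⟨c, hc.symm⟩
      le_add_self := fun a b => by
        simpa using add_le_add_left (hzero_le b 0 0) a
      le_self_add := fun a b => by
        simpa using add_le_add_right (hzero_le b 0 0) a }
  have hE : IsModel E :=
    { one_le := fun x => hdiscrete x x x
      ind := fun φ hφ v s => hφ.elim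
        (fun h => hT _ (.inl (.inl (.inr ⟨φ, h, rfl⟩))) v s)
        fun h => hT _ (.inr ⟨φ, h, rfl⟩) v s
      compr := fun φ ψ hφ hψ v s => hT _ (.inl (.inr ⟨φ, ψ, hφ, hψ, rfl⟩)) v s }
  exact hE.sat_orderedRamsey v s

end SOA

/-- Over `RCA₀`, the scheme `Σ⁰₂-IND` proves Ordered Ramsey's Theorem. -/
theorem mainTheorem4 : SOA.Proves (SOA.RCA0 ∪ SOA.SigmaIND 2) SOA.orderedRamsey := by
  exact SOA.proves_of_forall_sat fun _ _ _ _ _ _ _ _ hT v s => SOA.sat_orderedRamsey_of_sat hT v s
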